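/- Let $\alpha>0$. Let $M_0\subset\mathbb R^2$ be a smooth, strictly convex, complete, non-compact embedded curve whose two ends are asymptotic to the two lines $\{x_1=-1\}$ and $\{x_1=1\}$ as $x_2\to+\infty$. Let $X(p,t)$, $p\in\mathbb R$, $t\in[0,\infty)$, be a convex complete solution of the $\alpha$-curve shortening flow starting from $M_0$: $X$ is smooth for $t>0$ and continuous up to $t=0$, for each $t\ge 0$ the map $X(\cdot,t)$ is a smooth regular injective parametrization of a convex complete curve $M_t$ (the whole boundary of a closed convex set with nonempty interior), and for $t>0$ $$\frac{\partial X}{\partial t}(p,t)=\bar\kappa(p,t)^{\alpha}\,n(p,t),$$ where $\bar\kappa(p,t)\ge 0$ is the curvature of $M_t$ at $X(p,t)$ and $n(p,t)$ is the unit normal pointing towards the convex hull of $M_t$. Put $u=\bar\kappa^{\alpha}$, let $\partial_s$ denote differentiation along $M_t$ with respect to arc length, $u_s=\partial_s u$, and $B_r=\{x\in\mathbb R^2:|x|<r\}$. For every $\beta$ with $0<\beta<\min(1,1/\alpha)$ and every $L\in\mathbb R$ there is a constant $C=C(\alpha,\beta,L)$, independent of the solution, such that the following holds: if $0<u(p,t)\le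 L$ for all $t\ge 0$ and all $p$ with $X(p,t)\in B_1$, then for all $t>0$ and all $p$ with $X(p,t)\in B_{1/2}$ the function $u(\cdot,t)$ is differentiable at $p$ and $$|u_s(p,t)|\le C\,(1+t^{-1/2})\,u(p,t)^{\beta}.$$ -/

import Mathlib

open Set Filter Topology
open scoped ContDiff

namespace AlphaCSF

/-- The Euclidean plane. -/
abbrev Plane : Type := EuclideanSpace ℝ (Fin 2)

/-- Derivative `∂_s f` of a function `f` of the parameter of the regular curve `γ` with respect to
the arc length `s` of `γ`, oriented by the parameter: `∂_s = |γ'|⁻¹ ∂_p`. -/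
noncomputable def arcDeriv {F : Type*} [NormedAddCommGroup F] [NormedSpace ℝ F]
    (γ : ℝ → Plane) (f : ℝ → F) (p : ℝ) : F :=
  ‖deriv γ p‖⁻¹ • deriv f p

/-- The curvature `|∂_s ∂_s γ|` of a regular curve. For a convex curve this is the curvature with
respect to the inward normal, which is nonnegative. -/
noncomputable def curvature (γ : ℝ → Plane) (p : ℝ) : ℝ :=
  ‖arcDeriv γ (arcDeriv γ γ) p‖

/-- `γ` is a smooth regular injective parametrization, by the real line, of the whole boundary of
the closed set `K` with nonempty interior. (A connected non-compact curve is
diffeomorphic to the line. As its image is closed, such a curve is complete and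
properly embedded.) -/
structure ParametrizesBoundary (γ : ℝ → Plane) (K : Set Plane) : Prop where
  smooth : ContDiff ℝ ∞ γ
  regular : ∀ p, deriv γ p ≠ 0
  injective : Function.Injective γ
  isClosed : IsClosed K
  interior_nonempty : (interior K).Nonempty
  frontier_eq : frontier K = range γ

/-- `γ` parametrizes a smooth convex complete non-compact embedded curve. -/
def IsConvexCompleteCurve (γ : ℝ → Plane) : Prop :=
  ∃ K : Set Plane, Convex ℝ K ∧ ParametrizesBoundary γ K

/-- `γ` parametrizes a smooth strictly convex complete non-compact embedded curve. -/
def IsStrictlyConvexCompleteCurve (γ : ℝ → Plane) : Prop :=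
  ∃ K : Set Plane, StrictConvex ℝ K ∧ ParametrizesBoundary γ K

/-- Along the filter `l` of parameters, the curve `γ` is asymptotic to the vertical line `x₁ = c`
as `x₂ → +∞`. -/
def EndAsymptoticTo (γ : ℝ → Plane) (l : Filter ℝ) (c : ℝ) : Prop :=
  Tendsto (fun p => γ p 0) l (𝓝 c) ∧ Tendsto (fun p => γ p 1) l atTop

/-- The two ends of `γ` are asymptotic to the two lines `x₁ = -1` and `x₁ = 1` as `x₂ → +∞`
(in either orientation of the parameter). -/
def EndsAsymptoticToStrip (γ : ℝ → Plane) : Prop :=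
  (EndAsymptoticTo γ atBot (-1) ∧ EndAsymptoticTo γ atTop 1) ∨
    (EndAsymptoticTo γ atBot 1 ∧ EndAsymptoticTo γ atTop (-1))

/-- `n` is a unit normal of `γ` at the parameter `p` pointing to the side of the
convex hull of the curve. -/
structure IsInwardUnitNormal (γ : ℝ → Plane) (p : ℝ) (n : Plane) : Prop where
  norm_eq_one : ‖n‖ = 1
  orthogonal : inner ℝ n (deriv γ p) = 0
  inward : ∀ q, 0 ≤ inner ℝ n (γ q - γ p)

/-- The speed `u = κ^α` of the family of curves `p ↦ X p t`. -/
noncomputable def speed (α : ℝ) (X : ℝ → ℝ → Plane) (p t : ℝ) : ℝ :=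
  curvature (fun q => X q t) p ^ α

/-- `X : ℝ × [0, ∞) → ℝ²` is a convex complete solution of the `α`-curve shortening flow
`∂_t X = κ^α n`: it is smooth for `t > 0`, continuous up to `t = 0`, and each time slice,
`t = 0` included, is a smooth convex complete curve. Values of `X` at negative times play no
role. -/
structure IsConvexCompleteSolution (α : ℝ) (X : ℝ → ℝ → Plane) : Prop where
  smooth : ContDiffOn ℝ ∞ (fun z : ℝ × ℝ => X z.1 z.2) (univ ×ˢ Ioi 0)
  continuous : ContinuousOn (fun z : ℝ × ℝ => X z.1 z.2) (univ ×ˢ Ici 0)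
  convex_complete : ∀ t, 0 ≤ t → IsConvexCompleteCurve (fun p => X p t)
  flow : ∀ p t, 0 < t → ∃ n : Plane, IsInwardUnitNormal (fun q => X q t) p n ∧
    HasDerivAt (fun τ => X p τ) (speed α X p t • n) t

/-- A convex complete solution starting from a strictly convex
curve whose two ends are asymptotic to the lines `x₁ = ±1` as `x₂ → +∞`. -/
structure IsStripSolution (α : ℝ) (X : ℝ → ℝ → Plane) : Prop where
  solution : IsConvexCompleteSolution α X
  initial_strictly_convex : IsStrictlyConvexCompleteCurve (fun p => X p 0)
  initial_ends : EndsAsymptoticToStrip (fun p => X p 0)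

end AlphaCSF

/-! The proof is Bernstein's method, localized in space and time. Fix a time `T`, put e = (3/4)² -
|X|² and G = e u_s u^(-β) (`localGradient`), and maximize (t - T/2) G² over the part of the flow
with T/2 ≤ t ≤ T and |X| ≤ 3/4. This part is compact in space-time (`isCompact_region`): each time
slice is properly embedded by convexity, and the speed bound keeps points from entering the ball
from infinity in finite time.

If the maximum is not zero, it is attained where e > 0 and t > T/2. There G_s = 0 and G G_ss ≤ 0,
and the left time derivative of (t - T/2) G² is nonnegative; only the left one is available, since t
= T may occur. Insert the evolution equation u_t = α κ^(α-1) (u_ss + κ² u) and its arc length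
derivative. In a suitable combination of the two inequalities u_sss cancels, and G_s = 0 eliminates
u_ss. For Q = e u_s / u there remains (`gradient_ineq_of_max`, `quadratic_ineq_of_gradient_ineq`) β
(1/α - β) |Q|² ≤ A |Q| + B + κ / (2 α (t - T/2) u). The leading coefficient is positive because β <
1/α.

Since G = Q u^(1-β), multiplying by (t - T/2) u^(2-2β) bounds (t - T/2) G². The last term, singular
as u → 0, turns into a multiple of κ u^(1-2β) = u^(1/α + 1 - 2β), whose exponent is positive because
β < min(1, 1/α); so it is controlled by the upper bound of u (`exists_localGradient_bound`).
Comparing the maximum with the value at time `T` in the half ball, where e ≥ 5/16, gives the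
estimate. -/

namespace AlphaCSF

/-! ### Directional derivatives and one-variable conditions at extrema. -/

section Calculus

variable {V W E F : Type*} [NormedAddCommGroup V] [NormedSpace ℝ V]
  [NormedAddCommGroup W] [NormedSpace ℝ W]
  [NormedAddCommGroup E] [InnerProductSpace ℝ E]
  [NormedAddCommGroup F] [NormedSpace ℝ F]

/-- The derivative of `f` in the direction `e`. -/
noncomputable def dirDeriv (e : V) (f : V → F) (z : V) : F := fderiv ℝ f z e

variable {U : Set V} {z e e' : V}

theorem differentiableAt_of_contDiffOn (hU : IsOpen U) {f : V → F} (hf : ContDiffOn ℝ ∞ f U)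
    (hz : z ∈ U) : DifferentiableAt ℝ f z :=
  (hf.contDiffAt (hU.mem_nhds hz)).differentiableAt (by simp)

theorem contDiffOn_dirDeriv (hU : IsOpen U) {f : V → F} (hf : ContDiffOn ℝ ∞ f U) (e : V) :
    ContDiffOn ℝ ∞ (dirDeriv e f) U :=
  (hf.fderiv_of_isOpen hU (by simp)).clm_apply contDiffOn_const

theorem dirDeriv_congr (hU : IsOpen U) {f g : V → F} (h : EqOn f g U) (hz : z ∈ U) :
    dirDeriv e f z = dirDeriv e g z := by
  have : f =ᶠ[𝓝 z] g := h.eventuallyEq_of_mem (hU.mem_nhds hz)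
  simp only [dirDeriv, this.fderiv_eq]

theorem dirDeriv_comm (hU : IsOpen U) {f : V → F} (hf : ContDiffOn ℝ ∞ f U) (hz : z ∈ U) :
    dirDeriv e (dirDeriv e' f) z = dirDeriv e' (dirDeriv e f) z := by
  have hd : DifferentiableAt ℝ (fderiv ℝ f) z :=
    differentiableAt_of_contDiffOn hU (hf.fderiv_of_isOpen hU (by simp)) hz
  have hs : IsSymmSndFDerivAt ℝ f z := by
    apply ContDiffAt.isSymmSndFDerivAt (hf.contDiffAt (hU.mem_nhds hz))
    rw [minSmoothness_of_isRCLikeNormedField]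
    exact WithTop.coe_le_coe.2 le_top
  have key : ∀ a b : V, dirDeriv a (dirDeriv b f) z = fderiv ℝ (fderiv ℝ f) z a b := by
    intro a b
    have := (hd.hasFDerivAt.clm_apply (hasFDerivAt_const b z)).fderiv
    unfold dirDeriv
    rw [this]
    simp
  rw [key, key, hs]

theorem dirDeriv_const (c : F) : dirDeriv e (fun _ : V => c) z = 0 := by
  simp [dirDeriv]

theorem dirDeriv_smul {f : V → ℝ} {g : V → F} (hf : DifferentiableAt ℝ f z)
    (hg : DifferentiableAt ℝ g z) :
    dirDeriv e (fun y => f y • g y) z = f z • dirDeriv e g z + dirDeriv e f z • g z := by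
  have h : fderiv ℝ (fun y => f y • g y) z = _ := (hf.hasFDerivAt.smul hg.hasFDerivAt).fderiv
  simp [dirDeriv, h]

theorem dirDeriv_mul {f g : V → ℝ} (hf : DifferentiableAt ℝ f z) (hg : DifferentiableAt ℝ g z) :
    dirDeriv e (fun y => f y * g y) z = f z * dirDeriv e g z + dirDeriv e f z * g z :=
  dirDeriv_smul hf hg

theorem dirDeriv_add {f g : V → F} (hf : DifferentiableAt ℝ f z) (hg : DifferentiableAt ℝ g z) :
    dirDeriv e (fun y => f y + g y) z = dirDeriv e f z + dirDeriv e g z := by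
  have h : fderiv ℝ (fun y => f y + g y) z = _ := (hf.hasFDerivAt.add hg.hasFDerivAt).fderiv
  simp [dirDeriv, h]

theorem dirDeriv_sub {f g : V → F} (hf : DifferentiableAt ℝ f z) (hg : DifferentiableAt ℝ g z) :
    dirDeriv e (fun y => f y - g y) z = dirDeriv e f z - dirDeriv e g z := by
  have h : fderiv ℝ (fun y => f y - g y) z = _ := (hf.hasFDerivAt.sub hg.hasFDerivAt).fderiv
  simp [dirDeriv, h]

theorem dirDeriv_inner {f g : V → E} (hf : DifferentiableAt ℝ f z)
    (hg : DifferentiableAt ℝ g z) :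
    dirDeriv e (fun y => inner ℝ (f y) (g y)) z =
      inner ℝ (f z) (dirDeriv e g z) + inner ℝ (dirDeriv e f z) (g z) := by
  simp [dirDeriv, (hf.hasFDerivAt.inner ℝ hg.hasFDerivAt).fderiv]

theorem dirDeriv_rpow {f : V → ℝ} (hf : DifferentiableAt ℝ f z) (h : f z ≠ 0) (r : ℝ) :
    dirDeriv e (fun y => f y ^ r) z = r * f z ^ (r - 1) * dirDeriv e f z := by
  simp [dirDeriv, (hf.hasFDerivAt.rpow_const (p := r) (Or.inl h)).fderiv]

theorem hasDerivAt_fst {f : ℝ × ℝ → F} {p t : ℝ} (hf : DifferentiableAt ℝ f (p, t)) :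
    HasDerivAt (fun q => f (q, t)) (dirDeriv (1, 0) f (p, t)) p := by
  have h : HasDerivAt (fun q : ℝ => (q, t)) ((1 : ℝ), (0 : ℝ)) p :=
    (hasDerivAt_id p).prodMk (hasDerivAt_const p t)
  exact hf.hasFDerivAt.comp_hasDerivAt p h

theorem hasDerivAt_snd {f : ℝ × ℝ → F} {p t : ℝ} (hf : DifferentiableAt ℝ f (p, t)) :
    HasDerivAt (fun q => f (p, q)) (dirDeriv (0, 1) f (p, t)) t := by
  have h : HasDerivAt (fun q : ℝ => (p, q)) ((0 : ℝ), (1 : ℝ)) t :=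
    (hasDerivAt_const t p).prodMk (hasDerivAt_id t)
  exact hf.hasFDerivAt.comp_hasDerivAt t h

/-- The second derivative at a local minimum is nonnegative. -/
theorem second_deriv_nonneg_of_isLocalMin {f f' : ℝ → ℝ} {x f'' : ℝ} (h : IsLocalMin f x)
    (hf : ∀ᶠ y in 𝓝 x, HasDerivAt f (f' y) y) (hf' : HasDerivAt f' f'' x) : 0 ≤ f'' := by
  by_contra! hneg
  have e1 : deriv f =ᶠ[𝓝 x] f' := hf.mono fun y hy => hy.deriv
  have e2 : deriv (deriv f) x = f'' := by rw [e1.deriv_eq, hf'.deriv]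
  have hc : ContinuousAt f x := hf.self_of_nhds.continuousAt
  -- If f'' < 0, the second derivative test makes the minimum a local maximum as well, so f is
  -- locally constant and f'' = 0.
  have hmax : IsLocalMax f x := by
    have := isLocalMin_of_deriv_deriv_pos (f := fun y => -f y) (x₀ := x)
      (by simp only [deriv.fun_neg', e2, deriv.fun_neg]; linarith)
      (by simp [h.deriv_eq_zero]) hc.neg
    simpa using this.neg
  have hconst : f =ᶠ[𝓝 x] fun _ => f x := by
    filter_upwards [h, hmax] with y h1 h2 using le_antisymm h2 h1
  have : deriv f =ᶠ[𝓝 x] fun _ => 0 := by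
    have := hconst.deriv
    simpa using this
  have e3 : deriv (deriv f) x = 0 := by rw [this.deriv_eq]; simp
  linarith

/-- The derivative is nonnegative at a point where a maximum is attained from the left. -/
theorem deriv_nonneg_of_left_max {f : ℝ → ℝ} {x f' : ℝ} (hf : HasDerivAt f f' x)
    (h : ∀ᶠ y in 𝓝[<] x, f y ≤ f x) : 0 ≤ f' := by
  have := (hasDerivAt_iff_tendsto_slope.1 hf).mono_left
    (nhdsWithin_mono x (fun y (hy : y ∈ Iio x) => ne_of_lt hy))
  refine ge_of_tendsto this ?_
  filter_upwards [h, self_mem_nhdsWithin] with y hy hyx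
  rw [slope_def_field]
  exact div_nonneg_of_nonpos (by linarith) (by linarith [mem_Iio.1 hyx])

end Calculus

/-- In the plane, a vector orthogonal to the unit vector `n` is a multiple of any unit vector
orthogonal to `n`. -/
theorem eq_inner_smul_of_orthogonal {n T w : Plane} (hn : inner ℝ n n = 1)
    (hT : inner ℝ T T = 1) (hnT : inner ℝ n T = 0) (hnw : inner ℝ n w = 0) :
    w = inner ℝ w T • T := by
  simp only [PiLp.inner_apply, Fin.sum_univ_two, RCLike.inner_apply, conj_trivial] at *
  -- `T` is `n` turned by a right angle in one of the two directions; these identities are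
  -- quadratic, so they need no choice of orientation.
  have h1 : T 0 ^ 2 = n 1 ^ 2 := by
    linear_combination (n 1 ^ 2) * hT - T 0 ^ 2 * hn + (T 0 * n 0 - T 1 * n 1) * hnT
  have h2 : T 1 ^ 2 = n 0 ^ 2 := by linear_combination hT - hn - h1
  have h3 : T 0 * T 1 + n 0 * n 1 = 0 := by
    linear_combination (T 1 * n 0 + T 0 * n 1) * hnT - T 0 * T 1 * hn - n 0 * n 1 * hT
  ext i
  fin_cases i
  · simp only [Fin.zero_eta, PiLp.smul_apply, smul_eq_mul]
    linear_combination (-w 0) * hT + w 0 * h2 + n 0 * hnw - w 1 * h3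
  · simp only [Fin.mk_one, PiLp.smul_apply, smul_eq_mul]
    linear_combination (-w 1) * hT + w 1 * h1 + n 1 * hnw - w 0 * h3

/-! ### Frenet equations and evolution equations along the flow. -/

section Evolution

variable {F : Type*} [NormedAddCommGroup F] [NormedSpace ℝ F]

/-- Derivative in the parameter of the curves. -/
noncomputable abbrev paramDeriv (f : ℝ × ℝ → F) : ℝ × ℝ → F := dirDeriv ((1 : ℝ), (0 : ℝ)) f

/-- Derivative in time. -/
noncomputable abbrev timeDeriv (f : ℝ × ℝ → F) : ℝ × ℝ → F := dirDeriv ((0 : ℝ), (1 : ℝ)) f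

/-- The length of the tangent vector of the parametrized curves. -/
noncomputable def paramSpeed (X : ℝ × ℝ → Plane) (z : ℝ × ℝ) : ℝ := ‖paramDeriv X z‖

/-- The arc length derivative along a family of curves. -/
noncomputable def lengthDeriv (X : ℝ × ℝ → Plane) (f : ℝ × ℝ → F) (z : ℝ × ℝ) : F :=
  (paramSpeed X z)⁻¹ • paramDeriv f z

/-- The unit tangent. -/
noncomputable def unitTangent (X : ℝ × ℝ → Plane) : ℝ × ℝ → Plane := lengthDeriv X X

/-- The curvature of a family of curves. -/
noncomputable def familyCurvature (X : ℝ × ℝ → Plane) (z : ℝ × ℝ) : ℝ :=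
  ‖lengthDeriv X (unitTangent X) z‖

/-- The principal normal. -/
noncomputable def principalNormal (X : ℝ × ℝ → Plane) (z : ℝ × ℝ) : Plane :=
  (familyCurvature X z)⁻¹ • lengthDeriv X (unitTangent X) z

/-- The speed of the flow. -/
noncomputable def flowSpeed (α : ℝ) (X : ℝ × ℝ → Plane) (z : ℝ × ℝ) : ℝ :=
  familyCurvature X z ^ α

/-- In the open set `U` of space-time, `X` solves the `α`-curve shortening flow with positive
curvature. -/
structure IsLocalFlow (α : ℝ) (U : Set (ℝ × ℝ)) (X : ℝ × ℝ → Plane) : Prop where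
  isOpen : IsOpen U
  smooth : ContDiffOn ℝ ∞ X U
  regular : ∀ z ∈ U, paramDeriv X z ≠ 0
  curved : ∀ z ∈ U, lengthDeriv X (unitTangent X) z ≠ 0
  flow : ∀ z ∈ U, timeDeriv X z = flowSpeed α X z • principalNormal X z

namespace IsLocalFlow

variable {α : ℝ} {U : Set (ℝ × ℝ)} {X : ℝ × ℝ → Plane} {z : ℝ × ℝ}

theorem paramSpeed_pos (h : IsLocalFlow α U X) (hz : z ∈ U) : 0 < paramSpeed X z :=
  norm_pos_iff.2 (h.regular z hz)

theorem curvature_pos (h : IsLocalFlow α U X) (hz : z ∈ U) : 0 < familyCurvature X z :=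
  norm_pos_iff.2 (h.curved z hz)

theorem flowSpeed_pos (h : IsLocalFlow α U X) (hz : z ∈ U) : 0 < flowSpeed α X z :=
  Real.rpow_pos_of_pos (h.curvature_pos hz) α

theorem contDiffOn_paramDeriv (h : IsLocalFlow α U X) {f : ℝ × ℝ → F} (hf : ContDiffOn ℝ ∞ f U) :
    ContDiffOn ℝ ∞ (paramDeriv f) U := contDiffOn_dirDeriv h.isOpen hf _

theorem diff (h : IsLocalFlow α U X) {f : ℝ × ℝ → F} (hf : ContDiffOn ℝ ∞ f U) (hz : z ∈ U) :
    DifferentiableAt ℝ f z := differentiableAt_of_contDiffOn h.isOpen hf hz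

theorem contDiffOn_paramSpeed (h : IsLocalFlow α U X) : ContDiffOn ℝ ∞ (paramSpeed X) U :=
  (h.contDiffOn_paramDeriv h.smooth).norm ℝ h.regular

theorem contDiffOn_lengthDeriv (h : IsLocalFlow α U X) {f : ℝ × ℝ → F}
    (hf : ContDiffOn ℝ ∞ f U) : ContDiffOn ℝ ∞ (lengthDeriv X f) U :=
  (h.contDiffOn_paramSpeed.inv fun _ hz => (h.paramSpeed_pos hz).ne').smul
    (h.contDiffOn_paramDeriv hf)

theorem contDiffOn_unitTangent (h : IsLocalFlow α U X) : ContDiffOn ℝ ∞ (unitTangent X) U :=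
  h.contDiffOn_lengthDeriv h.smooth

theorem contDiffOn_curvature (h : IsLocalFlow α U X) : ContDiffOn ℝ ∞ (familyCurvature X) U :=
  (h.contDiffOn_lengthDeriv h.contDiffOn_unitTangent).norm ℝ h.curved

theorem contDiffOn_principalNormal (h : IsLocalFlow α U X) :
    ContDiffOn ℝ ∞ (principalNormal X) U :=
  (h.contDiffOn_curvature.inv fun _ hz => (h.curvature_pos hz).ne').smul
    (h.contDiffOn_lengthDeriv h.contDiffOn_unitTangent)

theorem contDiffOn_flowSpeed (h : IsLocalFlow α U X) : ContDiffOn ℝ ∞ (flowSpeed α X) U :=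
  h.contDiffOn_curvature.rpow_const_of_ne fun _ hz => (h.curvature_pos hz).ne'

theorem paramSpeed_smul_lengthDeriv (h : IsLocalFlow α U X) (hz : z ∈ U) (f : ℝ × ℝ → F) :
    paramSpeed X z • lengthDeriv X f z = paramDeriv f z := by
  rw [lengthDeriv, smul_smul, mul_inv_cancel₀ (h.paramSpeed_pos hz).ne', one_smul]

theorem curvature_smul_principalNormal (h : IsLocalFlow α U X) (hz : z ∈ U) :
    familyCurvature X z • principalNormal X z = lengthDeriv X (unitTangent X) z := by
  rw [principalNormal, smul_smul, mul_inv_cancel₀ (h.curvature_pos hz).ne', one_smul]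

theorem inner_tangent_tangent (h : IsLocalFlow α U X) (hz : z ∈ U) :
    inner ℝ (unitTangent X z) (unitTangent X z) = (1 : ℝ) := by
  have : ‖unitTangent X z‖ = 1 := by
    rw [unitTangent, lengthDeriv, norm_smul, norm_inv, Real.norm_of_nonneg (h.paramSpeed_pos hz).le]
    exact inv_mul_cancel₀ (h.paramSpeed_pos hz).ne'
  rw [real_inner_self_eq_norm_sq, this, one_pow]

theorem inner_normal_normal (h : IsLocalFlow α U X) (hz : z ∈ U) :
    inner ℝ (principalNormal X z) (principalNormal X z) = (1 : ℝ) := by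
  have : ‖principalNormal X z‖ = 1 := by
    rw [principalNormal, norm_smul, norm_inv, Real.norm_of_nonneg (h.curvature_pos hz).le]
    exact inv_mul_cancel₀ (h.curvature_pos hz).ne'
  rw [real_inner_self_eq_norm_sq, this, one_pow]

theorem inner_dirDeriv_self_eq_zero (h : IsLocalFlow α U X) {f : ℝ × ℝ → Plane}
    (hf : ContDiffOn ℝ ∞ f U) (h1 : ∀ z ∈ U, inner ℝ (f z) (f z) = (1 : ℝ)) (hz : z ∈ U)
    (e : ℝ × ℝ) : inner ℝ (f z) (dirDeriv e f z) = (0 : ℝ) := by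
  have h2 := dirDeriv_inner (e := e) (h.diff hf hz) (h.diff hf hz)
  rw [dirDeriv_congr h.isOpen (g := fun _ => (1 : ℝ)) h1 hz, dirDeriv_const,
    real_inner_comm (f z) (dirDeriv e f z)] at h2
  linarith

theorem paramDeriv_tangent (h : IsLocalFlow α U X) (hz : z ∈ U) :
    paramDeriv (unitTangent X) z =
      (paramSpeed X z * familyCurvature X z) • principalNormal X z := by
  rw [mul_smul, h.curvature_smul_principalNormal hz, h.paramSpeed_smul_lengthDeriv hz]

theorem inner_normal_tangent (h : IsLocalFlow α U X) (hz : z ∈ U) :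
    inner ℝ (principalNormal X z) (unitTangent X z) = (0 : ℝ) := by
  have h1 := h.inner_dirDeriv_self_eq_zero h.contDiffOn_unitTangent
    (fun z hz => h.inner_tangent_tangent hz) hz (1, 0)
  have h2 := h.paramDeriv_tangent hz
  rw [paramDeriv] at h2
  rw [h2, inner_smul_right, real_inner_comm] at h1
  exact (mul_eq_zero.1 h1).resolve_left
    (mul_pos (h.paramSpeed_pos hz) (h.curvature_pos hz)).ne'

theorem paramDeriv_normal (h : IsLocalFlow α U X) (hz : z ∈ U) :
    paramDeriv (principalNormal X) z =
      (-(paramSpeed X z * familyCurvature X z)) • unitTangent X z := by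
  have h1 := h.inner_dirDeriv_self_eq_zero h.contDiffOn_principalNormal
    (fun z hz => h.inner_normal_normal hz) hz (1, 0)
  have h2 := dirDeriv_inner (e := (1, 0)) (h.diff h.contDiffOn_principalNormal hz)
    (h.diff h.contDiffOn_unitTangent hz)
  rw [dirDeriv_congr h.isOpen (g := fun _ => (0 : ℝ)) (fun z hz => h.inner_normal_tangent hz) hz,
    dirDeriv_const] at h2
  have h3 := h.paramDeriv_tangent hz
  rw [paramDeriv] at h3
  rw [h3, inner_smul_right, h.inner_normal_normal hz] at h2
  rw [paramDeriv, eq_inner_smul_of_orthogonal (h.inner_normal_normal hz) (h.inner_tangent_tangent hz)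
    (h.inner_normal_tangent hz) h1]
  congr 1
  linarith

theorem paramDeriv_velocity (h : IsLocalFlow α U X) (hz : z ∈ U) :
    paramDeriv (timeDeriv X) z = paramDeriv (flowSpeed α X) z • principalNormal X z -
      (paramSpeed X z * familyCurvature X z * flowSpeed α X z) • unitTangent X z := by
  have h1 := dirDeriv_smul (e := (1, 0)) (h.diff h.contDiffOn_flowSpeed hz)
    (h.diff h.contDiffOn_principalNormal hz)
  have h2 := h.paramDeriv_normal hz
  rw [paramDeriv] at h2
  rw [paramDeriv, dirDeriv_congr h.isOpen h.flow hz, h1, h2, smul_smul, paramDeriv]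
  module

/-- With v the length of the tangent vector X_p, both formulas come from differentiating X_p = v T
in time and exchanging derivatives: the tangential part of (u N)_p gives v_t, and the normal part
gives T_t. -/
theorem timeDeriv_paramSpeed (h : IsLocalFlow α U X) (hz : z ∈ U) :
    timeDeriv (paramSpeed X) z =
      -(familyCurvature X z * flowSpeed α X z * paramSpeed X z) ∧
    timeDeriv (unitTangent X) z =
      lengthDeriv X (flowSpeed α X) z • principalNormal X z := by
  have hv := h.paramSpeed_pos hz
  have h1 := dirDeriv_smul (e := (0, 1)) (h.diff h.contDiffOn_paramSpeed hz)
    (h.diff h.contDiffOn_unitTangent hz)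
  have hX : EqOn (fun y => paramSpeed X y • unitTangent X y) (paramDeriv X) U :=
    fun y hy => h.paramSpeed_smul_lengthDeriv hy X
  have h0 := h.paramDeriv_velocity hz
  rw [paramDeriv, timeDeriv] at h0
  rw [dirDeriv_congr h.isOpen hX hz, dirDeriv_comm h.isOpen h.smooth hz, h0] at h1
  have h2 := congrArg (fun w => inner ℝ w (unitTangent X z)) h1
  have h3 := h.inner_dirDeriv_self_eq_zero h.contDiffOn_unitTangent
    (fun z hz => h.inner_tangent_tangent hz) hz (0, 1)
  rw [real_inner_comm] at h3
  simp only [inner_sub_left, inner_add_left, inner_smul_left, h.inner_normal_tangent hz,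
    h.inner_tangent_tangent hz, h3, conj_trivial] at h2
  have h4 : timeDeriv (paramSpeed X) z =
      -(familyCurvature X z * flowSpeed α X z * paramSpeed X z) := by
    rw [timeDeriv]; linarith
  refine ⟨h4, ?_⟩
  rw [timeDeriv] at h4
  rw [h4] at h1
  have h5 : paramSpeed X z • dirDeriv (0, 1) (unitTangent X) z =
      paramDeriv (flowSpeed α X) z • principalNormal X z := by
    have : (-(familyCurvature X z * flowSpeed α X z * paramSpeed X z)) • unitTangent X z =
      -((paramSpeed X z * familyCurvature X z * flowSpeed α X z) • unitTangent X z) := by module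
    rw [this, sub_eq_add_neg] at h1
    exact (add_right_cancel h1).symm
  rw [lengthDeriv, smul_assoc, ← h5, smul_smul, inv_mul_cancel₀ hv.ne', one_smul]

/-- Compare T_pt with T_tp, using T_p = v κ N and T_t = u_s N, and take the component along N; N_t
drops out because N has constant length. -/
theorem timeDeriv_curvature (h : IsLocalFlow α U X) (hz : z ∈ U) :
    timeDeriv (familyCurvature X) z =
      lengthDeriv X (lengthDeriv X (flowSpeed α X)) z +
        familyCurvature X z ^ 2 * flowSpeed α X z := by
  have hv := h.paramSpeed_pos hz
  have hu := h.contDiffOn_flowSpeed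
  have h1 := dirDeriv_smul (e := (0, 1)) (f := fun y => paramSpeed X y * familyCurvature X y)
    ((h.diff h.contDiffOn_paramSpeed hz).mul (h.diff h.contDiffOn_curvature hz))
    (h.diff h.contDiffOn_principalNormal hz)
  have hT : EqOn (fun y => (paramSpeed X y * familyCurvature X y) • principalNormal X y)
    (paramDeriv (unitTangent X)) U := fun y hy => (h.paramDeriv_tangent hy).symm
  have hmul := dirDeriv_mul (e := (0, 1)) (h.diff h.contDiffOn_paramSpeed hz)
    (h.diff h.contDiffOn_curvature hz)
  have hsm := dirDeriv_smul (e := (1, 0)) (h.diff (h.contDiffOn_lengthDeriv hu) hz)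
    (h.diff h.contDiffOn_principalNormal hz)
  have h2 := h.paramDeriv_normal hz
  have h4 := (h.timeDeriv_paramSpeed hz).1
  have h3 := h.inner_dirDeriv_self_eq_zero h.contDiffOn_principalNormal
    (fun z hz => h.inner_normal_normal hz) hz (0, 1)
  rw [real_inner_comm] at h3
  have h5 := h.inner_normal_tangent hz
  rw [real_inner_comm] at h5
  rw [dirDeriv_congr h.isOpen hT hz, dirDeriv_comm h.isOpen h.contDiffOn_unitTangent hz,
    dirDeriv_congr h.isOpen (fun y hy => (h.timeDeriv_paramSpeed hy).2) hz, hsm] at h1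
  rw [paramDeriv] at h2
  rw [timeDeriv] at h4
  replace h1 := congrArg (fun w => inner ℝ w (principalNormal X z)) h1
  rw [h2, hmul, h4] at h1
  simp only [inner_add_left, inner_smul_left, h5, h.inner_normal_normal hz, h3,
    conj_trivial] at h1
  rw [timeDeriv]
  have h6 := h.paramSpeed_smul_lengthDeriv hz (lengthDeriv X (flowSpeed α X))
  rw [paramDeriv, smul_eq_mul] at h6
  rw [← h6] at h1
  apply mul_left_cancel₀ hv.ne'
  linarith

/-- The factor `α κ^(α - 1)` in the evolution equation of the speed. -/
noncomputable def diffusivity (α : ℝ) (X : ℝ × ℝ → Plane) (z : ℝ × ℝ) : ℝ :=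
  α * familyCurvature X z ^ (α - 1)

theorem contDiffOn_diffusivity (h : IsLocalFlow α U X) :
    ContDiffOn ℝ ∞ (diffusivity α X) U :=
  contDiffOn_const.mul
    (h.contDiffOn_curvature.rpow_const_of_ne fun _ hz => (h.curvature_pos hz).ne')

theorem dirDeriv_flowSpeed (h : IsLocalFlow α U X) (hz : z ∈ U) (e : ℝ × ℝ) :
    dirDeriv e (flowSpeed α X) z = diffusivity α X z * dirDeriv e (familyCurvature X) z :=
  dirDeriv_rpow (h.diff h.contDiffOn_curvature hz) (h.curvature_pos hz).ne' α

/-- The factor κ on the left avoids the power κ^(α-2), so that the later algebra contains only u, κ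
and the diffusivity. -/
theorem dirDeriv_diffusivity (h : IsLocalFlow α U X) (hz : z ∈ U) (e : ℝ × ℝ) :
    familyCurvature X z * dirDeriv e (diffusivity α X) z =
      (α - 1) * dirDeriv e (flowSpeed α X) z := by
  have hk := h.curvature_pos hz
  have h0 := h.contDiffOn_curvature.rpow_const_of_ne (p := α - 1)
    fun _ hz => (h.curvature_pos hz).ne'
  have h1 := dirDeriv_rpow (e := e) (h.diff h.contDiffOn_curvature hz) hk.ne' (α - 1)
  have h2 := dirDeriv_mul (e := e) (differentiableAt_const (x := z) α) (h.diff h0 hz)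
  rw [dirDeriv_const, h1] at h2
  have h3 : dirDeriv e (diffusivity α X) z = _ := h2
  rw [h3, h.dirDeriv_flowSpeed hz, diffusivity]
  have : familyCurvature X z ^ (α - 1) =
      familyCurvature X z ^ (α - 1 - 1) * familyCurvature X z := by
    rw [← Real.rpow_add_one hk.ne']; ring_nf
  rw [this]
  ring

theorem timeDeriv_flowSpeed (h : IsLocalFlow α U X) (hz : z ∈ U) :
    timeDeriv (flowSpeed α X) z = diffusivity α X z *
      (lengthDeriv X (lengthDeriv X (flowSpeed α X)) z +
        familyCurvature X z ^ 2 * flowSpeed α X z) := by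
  rw [timeDeriv, h.dirDeriv_flowSpeed hz, ← h.timeDeriv_curvature hz]

/-- Commutator of the time derivative with the arc length derivative. -/
theorem timeDeriv_lengthDeriv (h : IsLocalFlow α U X) {f : ℝ × ℝ → ℝ} (hf : ContDiffOn ℝ ∞ f U)
    (hz : z ∈ U) :
    timeDeriv (lengthDeriv X f) z = lengthDeriv X (timeDeriv f) z +
      familyCurvature X z * flowSpeed α X z * lengthDeriv X f z := by
  have hv := h.paramSpeed_pos hz
  have h1 := dirDeriv_mul (e := (0, 1)) (h.diff h.contDiffOn_paramSpeed hz)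
    (h.diff (h.contDiffOn_lengthDeriv hf) hz)
  have h4 := (h.timeDeriv_paramSpeed hz).1
  rw [timeDeriv] at h4
  have h0 : EqOn (fun y => paramSpeed X y * lengthDeriv X f y) (paramDeriv f) U :=
    fun y hy => h.paramSpeed_smul_lengthDeriv hy f
  rw [dirDeriv_congr h.isOpen h0 hz, dirDeriv_comm h.isOpen hf hz, h4] at h1
  have h5 := h.paramSpeed_smul_lengthDeriv hz (timeDeriv f)
  rw [smul_eq_mul, paramDeriv, h1] at h5
  rw [timeDeriv]
  apply mul_left_cancel₀ hv.ne'
  linarith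

theorem lengthDeriv_congr (h : IsLocalFlow α U X) {f g : ℝ × ℝ → F} (hfg : EqOn f g U)
    (hz : z ∈ U) : lengthDeriv X f z = lengthDeriv X g z := by
  rw [lengthDeriv, lengthDeriv, paramDeriv, paramDeriv, dirDeriv_congr h.isOpen hfg hz]

theorem lengthDeriv_mul (h : IsLocalFlow α U X) {f g : ℝ × ℝ → ℝ} (hf : ContDiffOn ℝ ∞ f U)
    (hg : ContDiffOn ℝ ∞ g U) (hz : z ∈ U) :
    lengthDeriv X (fun y => f y * g y) z =
      f z * lengthDeriv X g z + lengthDeriv X f z * g z := by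
  simp only [lengthDeriv, paramDeriv, dirDeriv_mul (h.diff hf hz) (h.diff hg hz), smul_eq_mul]
  ring

theorem lengthDeriv_add (h : IsLocalFlow α U X) {f g : ℝ × ℝ → ℝ} (hf : ContDiffOn ℝ ∞ f U)
    (hg : ContDiffOn ℝ ∞ g U) (hz : z ∈ U) :
    lengthDeriv X (fun y => f y + g y) z = lengthDeriv X f z + lengthDeriv X g z := by
  simp only [lengthDeriv, paramDeriv, dirDeriv_add (h.diff hf hz) (h.diff hg hz), smul_eq_mul]
  ring

theorem lengthDeriv_rpow (h : IsLocalFlow α U X) {f : ℝ × ℝ → ℝ} (hf : ContDiffOn ℝ ∞ f U)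
    (hz : z ∈ U) (h0 : f z ≠ 0) (r : ℝ) :
    lengthDeriv X (fun y => f y ^ r) z = r * f z ^ (r - 1) * lengthDeriv X f z := by
  simp only [lengthDeriv, paramDeriv, dirDeriv_rpow (h.diff hf hz) h0, smul_eq_mul]
  ring

theorem lengthDeriv_inner (h : IsLocalFlow α U X) {f g : ℝ × ℝ → Plane}
    (hf : ContDiffOn ℝ ∞ f U) (hg : ContDiffOn ℝ ∞ g U) (hz : z ∈ U) :
    lengthDeriv X (fun y => inner ℝ (f y) (g y)) z =
      inner ℝ (f z) (lengthDeriv X g z) + inner ℝ (lengthDeriv X f z) (g z) := by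
  simp only [lengthDeriv, paramDeriv, dirDeriv_inner (h.diff hf hz) (h.diff hg hz), smul_eq_mul,
    inner_smul_left, inner_smul_right, conj_trivial]
  ring

/-- The evolution equation of `u_s`. -/
theorem timeDeriv_lengthDeriv_flowSpeed (h : IsLocalFlow α U X) (hz : z ∈ U) :
    familyCurvature X z * timeDeriv (lengthDeriv X (flowSpeed α X)) z =
      familyCurvature X z * diffusivity α X z *
        (lengthDeriv X (lengthDeriv X (lengthDeriv X (flowSpeed α X))) z +
          familyCurvature X z ^ 2 * lengthDeriv X (flowSpeed α X) z) +
      2 * familyCurvature X z ^ 2 * flowSpeed α X z * lengthDeriv X (flowSpeed α X) z +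
      (α - 1) * lengthDeriv X (flowSpeed α X) z *
        (lengthDeriv X (lengthDeriv X (flowSpeed α X)) z +
          familyCurvature X z ^ 2 * flowSpeed α X z) +
      familyCurvature X z ^ 2 * flowSpeed α X z * lengthDeriv X (flowSpeed α X) z := by
  have hk := h.contDiffOn_curvature
  have hu := h.contDiffOn_flowSpeed
  have hus := h.contDiffOn_lengthDeriv hu
  have huss := h.contDiffOn_lengthDeriv hus
  have hkk := hk.mul hk
  have hkku := hkk.mul hu
  -- The equation of u_t holds on all of `U`, hence may be differentiated in s; the commutator of
  -- ∂_t and ∂_s contributes the last term κ² u u_s of the goal.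
  have e : EqOn (timeDeriv (flowSpeed α X)) (fun y => diffusivity α X y *
      (lengthDeriv X (lengthDeriv X (flowSpeed α X)) y +
        (familyCurvature X y * familyCurvature X y) * flowSpeed α X y)) U := by
    intro y hy
    rw [h.timeDeriv_flowSpeed hy, pow_two]
  have ha : familyCurvature X z * lengthDeriv X (diffusivity α X) z =
      (α - 1) * lengthDeriv X (flowSpeed α X) z := by
    have := h.dirDeriv_diffusivity hz (1, 0)
    simp only [lengthDeriv, paramDeriv, smul_eq_mul]
    linear_combination (paramSpeed X z)⁻¹ * this
  have hb : lengthDeriv X (flowSpeed α X) z =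
      diffusivity α X z * lengthDeriv X (familyCurvature X) z := by
    have := h.dirDeriv_flowSpeed hz (1, 0)
    simp only [lengthDeriv, paramDeriv, smul_eq_mul]
    linear_combination (paramSpeed X z)⁻¹ * this
  rw [h.timeDeriv_lengthDeriv hu hz, h.lengthDeriv_congr e hz,
    h.lengthDeriv_mul h.contDiffOn_diffusivity (huss.add hkku) hz,
    h.lengthDeriv_add huss hkku hz, h.lengthDeriv_mul hkk hu hz, h.lengthDeriv_mul hk hk hz]
  linear_combination (lengthDeriv X (lengthDeriv X (flowSpeed α X)) z +
    familyCurvature X z * familyCurvature X z * flowSpeed α X z) * ha -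
    2 * familyCurvature X z ^ 2 * flowSpeed α X z * hb

end IsLocalFlow

end Evolution

/-! ### The localized gradient: conditions at a maximum, and its derivatives. -/

/-- The cutoff function `r² - |X|²`. -/
noncomputable def cutoff (r : ℝ) (X : ℝ × ℝ → Plane) (z : ℝ × ℝ) : ℝ :=
  r ^ 2 - inner ℝ (X z) (X z)

/-- The localized weighted gradient `(r² - |X|²) u_s u^(-β)`. -/
noncomputable def localGradient (α β r : ℝ) (X : ℝ × ℝ → Plane) (z : ℝ × ℝ) : ℝ :=
  cutoff r X z * (lengthDeriv X (flowSpeed α X) z * flowSpeed α X z ^ (-β))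

namespace IsLocalFlow

variable {α β r : ℝ} {U : Set (ℝ × ℝ)} {X : ℝ × ℝ → Plane} {z : ℝ × ℝ}

/-- Squaring G treats both signs of u_s at once. The conditions are obtained in the parameter and
pass to arc length because at a critical point G_pp = v² G_ss: the term containing v_p carries the
factor G_s = 0. -/
theorem lengthDeriv_eq_zero_of_isLocalMax_sq (h : IsLocalFlow α U X) {G : ℝ × ℝ → ℝ}
    (hG : ContDiffOn ℝ ∞ G U) {p t : ℝ} (hz : (p, t) ∈ U) (hne : G (p, t) ≠ 0)
    (hmax : ∀ᶠ q in 𝓝 p, G (q, t) ^ 2 ≤ G (p, t) ^ 2) :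
    lengthDeriv X G (p, t) = 0 ∧ G (p, t) * lengthDeriv X (lengthDeriv X G) (p, t) ≤ 0 := by
  have hGp := h.contDiffOn_paramDeriv hG
  have hd : ∀ᶠ q in 𝓝 p, HasDerivAt (fun q => -G (q, t) ^ 2)
      (-(2 * G (q, t) * paramDeriv G (q, t))) q := by
    have hc : ContinuousAt (fun q : ℝ => (q, t)) p := by fun_prop
    filter_upwards [hc.preimage_mem_nhds (h.isOpen.mem_nhds hz)] with q hq
    simpa using ((hasDerivAt_fst (h.diff hG hq)).fun_pow 2).fun_neg
  have hmin : IsLocalMin (fun q => -G (q, t) ^ 2) p := by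
    filter_upwards [hmax] with q hq
    linarith
  have h1 : paramDeriv G (p, t) = 0 := by
    have := hmin.hasDerivAt_eq_zero hd.self_of_nhds
    simpa [hne] using this
  have h2 := second_deriv_nonneg_of_isLocalMin hmin hd
    (((hasDerivAt_fst (h.diff hG hz)).const_mul 2).mul (hasDerivAt_fst (h.diff hGp hz))).neg
  have h3 : lengthDeriv X G (p, t) = 0 := by rw [lengthDeriv, h1, smul_zero]
  refine ⟨h3, ?_⟩
  have hv := h.paramSpeed_pos hz
  have h4 := dirDeriv_mul (e := (1, 0)) (h.diff h.contDiffOn_paramSpeed hz)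
    (h.diff (h.contDiffOn_lengthDeriv hG) hz)
  have h0 : EqOn (fun y => paramSpeed X y * lengthDeriv X G y) (paramDeriv G) U :=
    fun y hy => h.paramSpeed_smul_lengthDeriv hy G
  have h5 := h.paramSpeed_smul_lengthDeriv hz (lengthDeriv X G)
  rw [dirDeriv_congr h.isOpen h0 hz, h3, mul_zero, add_zero] at h4
  rw [smul_eq_mul, paramDeriv] at h5
  rw [h1, h4, ← h5] at h2
  have h6 : 0 ≤ paramSpeed X (p, t) ^ 2 *
      -(G (p, t) * lengthDeriv X (lengthDeriv X G) (p, t)) := by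
    linarith
  have := nonneg_of_mul_nonneg_right h6 (by positivity)
  linarith

theorem timeDeriv_of_left_max (h : IsLocalFlow α U X) {G : ℝ × ℝ → ℝ}
    (hG : ContDiffOn ℝ ∞ G U) {a p t : ℝ} (hz : (p, t) ∈ U)
    (hmax : ∀ᶠ τ in 𝓝[<] t, (τ - a) * G (p, τ) ^ 2 ≤ (t - a) * G (p, t) ^ 2) :
    0 ≤ G (p, t) ^ 2 + 2 * (t - a) * (G (p, t) * timeDeriv G (p, t)) := by
  have := deriv_nonneg_of_left_max
    (((hasDerivAt_id t).sub_const a).mul ((hasDerivAt_snd (h.diff hG hz)).pow 2)) hmax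
  simp only [id, Pi.pow_apply, Nat.cast_ofNat, Nat.add_one_sub_one, pow_one] at this
  rw [timeDeriv]
  linarith

theorem contDiffOn_cutoff (h : IsLocalFlow α U X) : ContDiffOn ℝ ∞ (cutoff r X) U :=
  contDiffOn_const.sub (h.smooth.inner ℝ h.smooth)

theorem dirDeriv_cutoff (h : IsLocalFlow α U X) (hz : z ∈ U) (e : ℝ × ℝ) :
    dirDeriv e (cutoff r X) z = -2 * inner ℝ (X z) (dirDeriv e X z) := by
  have hX := h.diff h.smooth hz
  have h1 := dirDeriv_sub (e := e) (differentiableAt_const (x := z) (r ^ 2)) (hX.inner ℝ hX)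
  rw [dirDeriv_const, dirDeriv_inner hX hX, real_inner_comm (X z) (dirDeriv e X z)] at h1
  have h2 : dirDeriv e (cutoff r X) z = _ := h1
  rw [h2]
  ring

theorem lengthDeriv_cutoff (h : IsLocalFlow α U X) (hz : z ∈ U) :
    lengthDeriv X (cutoff r X) z = -2 * inner ℝ (X z) (unitTangent X z) := by
  rw [lengthDeriv, paramDeriv, h.dirDeriv_cutoff hz, unitTangent, lengthDeriv, inner_smul_right,
    smul_eq_mul]
  ring

theorem lengthDeriv_lengthDeriv_cutoff (h : IsLocalFlow α U X) (hz : z ∈ U) :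
    lengthDeriv X (lengthDeriv X (cutoff r X)) z =
      -2 * (1 + familyCurvature X z * inner ℝ (X z) (principalNormal X z)) := by
  have hT := h.contDiffOn_unitTangent
  have hi : ContDiffOn ℝ ∞ (fun y => (inner ℝ (X y) (unitTangent X y) : ℝ)) U :=
    h.smooth.inner ℝ hT
  have h1 := h.lengthDeriv_mul (contDiffOn_const (c := (-2 : ℝ))) hi hz
  rw [h.lengthDeriv_congr (fun y hy => h.lengthDeriv_cutoff hy) hz, h1,
    h.lengthDeriv_inner h.smooth hT hz, ← h.curvature_smul_principalNormal hz, inner_smul_right,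
    ← unitTangent, h.inner_tangent_tangent hz]
  simp only [lengthDeriv, paramDeriv, dirDeriv_const, smul_zero]
  ring

theorem timeDeriv_cutoff (h : IsLocalFlow α U X) (hz : z ∈ U) :
    timeDeriv (cutoff r X) z =
      -2 * (flowSpeed α X z * inner ℝ (X z) (principalNormal X z)) := by
  rw [timeDeriv, h.dirDeriv_cutoff hz, ← timeDeriv, h.flow z hz, inner_smul_right]

theorem contDiffOn_localGradient (h : IsLocalFlow α U X) :
    ContDiffOn ℝ ∞ (localGradient α β r X) U :=
  h.contDiffOn_cutoff.mul ((h.contDiffOn_lengthDeriv h.contDiffOn_flowSpeed).mul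
    (h.contDiffOn_flowSpeed.rpow_const_of_ne fun _ hz => (h.flowSpeed_pos hz).ne'))

theorem lengthDeriv_localGradient (h : IsLocalFlow α U X) (hz : z ∈ U) :
    lengthDeriv X (localGradient α β r X) z = flowSpeed α X z ^ (-β) *
      (lengthDeriv X (cutoff r X) z * lengthDeriv X (flowSpeed α X) z +
        cutoff r X z * (lengthDeriv X (lengthDeriv X (flowSpeed α X)) z -
          β * (lengthDeriv X (flowSpeed α X) z ^ 2 * (flowSpeed α X z)⁻¹))) := by
  have hu := h.contDiffOn_flowSpeed
  have hf := h.contDiffOn_lengthDeriv hu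
  have h0 := (h.flowSpeed_pos hz).ne'
  have hb := hu.rpow_const_of_ne (p := -β) fun _ hz => (h.flowSpeed_pos hz).ne'
  have hG : lengthDeriv X (localGradient α β r X) z = _ :=
    h.lengthDeriv_mul h.contDiffOn_cutoff (hf.mul hb) hz
  rw [hG, h.lengthDeriv_mul hf hb hz, h.lengthDeriv_rpow hu hz h0, Real.rpow_sub_one h0]
  ring

/-- G_s is u^(-β) times a bracket which vanishes at a critical point, so the derivative of the
weight u^(-β) does not contribute. -/
theorem lengthDeriv_lengthDeriv_localGradient (h : IsLocalFlow α U X) (hz : z ∈ U)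
    (hcrit : lengthDeriv X (localGradient α β r X) z = 0) :
    lengthDeriv X (lengthDeriv X (localGradient α β r X)) z = flowSpeed α X z ^ (-β) *
      (lengthDeriv X (lengthDeriv X (cutoff r X)) z * lengthDeriv X (flowSpeed α X) z +
        2 * lengthDeriv X (cutoff r X) z * lengthDeriv X (lengthDeriv X (flowSpeed α X)) z +
        cutoff r X z * lengthDeriv X (lengthDeriv X (lengthDeriv X (flowSpeed α X))) z -
        β * (lengthDeriv X (cutoff r X) z * lengthDeriv X (flowSpeed α X) z ^ 2 *
            (flowSpeed α X z)⁻¹ +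
          2 * cutoff r X z * lengthDeriv X (flowSpeed α X) z *
            lengthDeriv X (lengthDeriv X (flowSpeed α X)) z * (flowSpeed α X z)⁻¹ -
          cutoff r X z * lengthDeriv X (flowSpeed α X) z ^ 3 * (flowSpeed α X z)⁻¹ ^ 2)) := by
  have hu := h.contDiffOn_flowSpeed
  have hf := h.contDiffOn_lengthDeriv hu
  have hff := h.contDiffOn_lengthDeriv hf
  have he := h.contDiffOn_cutoff (r := r)
  have hes := h.contDiffOn_lengthDeriv he
  have h0 := (h.flowSpeed_pos hz).ne'
  have hne : ∀ y ∈ U, flowSpeed α X y ≠ 0 := fun _ hy => (h.flowSpeed_pos hy).ne'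
  have hb := hu.rpow_const_of_ne (p := -β) hne
  have hi := hu.rpow_const_of_ne (p := -1) hne
  have hc := contDiffOn_const (𝕜 := ℝ) (n := ∞) (s := U) (c := -β)
  have hq := hc.mul ((hf.mul hf).mul hi)
  have e : EqOn (lengthDeriv X (localGradient α β r X)) (fun y => flowSpeed α X y ^ (-β) *
      (lengthDeriv X (cutoff r X) y * lengthDeriv X (flowSpeed α X) y +
        cutoff r X y * (lengthDeriv X (lengthDeriv X (flowSpeed α X)) y +
          (-β) * ((lengthDeriv X (flowSpeed α X) y * lengthDeriv X (flowSpeed α X) y) *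
            flowSpeed α X y ^ (-1 : ℝ))))) U := by
    intro y hy
    simp only [h.lengthDeriv_localGradient hy, Real.rpow_neg_one]
    ring
  have hpos : flowSpeed α X z ^ (-β) ≠ 0 :=
    (Real.rpow_pos_of_pos (h.flowSpeed_pos hz) _).ne'
  have hR := e hz
  rw [hcrit] at hR
  replace hR := (mul_eq_zero.1 hR.symm).resolve_left hpos
  rw [h.lengthDeriv_congr e hz,
    h.lengthDeriv_mul hb ((hes.mul hf).add (he.mul (hff.add hq))) hz, hR, mul_zero, add_zero,
    h.lengthDeriv_add (hes.mul hf) (he.mul (hff.add hq)) hz, h.lengthDeriv_mul hes hf hz,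
    h.lengthDeriv_mul he (hff.add hq) hz, h.lengthDeriv_add hff hq hz,
    h.lengthDeriv_mul hc ((hf.mul hf).mul hi) hz, h.lengthDeriv_mul (hf.mul hf) hi hz,
    h.lengthDeriv_mul hf hf hz, h.lengthDeriv_rpow hu hz h0, Real.rpow_sub_one h0,
    Real.rpow_neg_one]
  have hcc : lengthDeriv X (fun _ : ℝ × ℝ => -β) z = 0 := by
    simp only [lengthDeriv, paramDeriv, dirDeriv_const, smul_zero]
  rw [hcc]
  ring

theorem timeDeriv_localGradient (h : IsLocalFlow α U X) (hz : z ∈ U) :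
    timeDeriv (localGradient α β r X) z = flowSpeed α X z ^ (-β) *
      (timeDeriv (cutoff r X) z * lengthDeriv X (flowSpeed α X) z +
        cutoff r X z * (timeDeriv (lengthDeriv X (flowSpeed α X)) z -
          β * (lengthDeriv X (flowSpeed α X) z * timeDeriv (flowSpeed α X) z *
            (flowSpeed α X z)⁻¹))) := by
  have hu := h.contDiffOn_flowSpeed
  have hf := h.contDiffOn_lengthDeriv hu
  have h0 := (h.flowSpeed_pos hz).ne'
  have hb := hu.rpow_const_of_ne (p := -β) fun _ hz => (h.flowSpeed_pos hz).ne'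
  have hG : timeDeriv (localGradient α β r X) z = _ :=
    dirDeriv_mul (h.diff h.contDiffOn_cutoff hz) ((h.diff hf hz).mul (h.diff hb hz))
  simp only [timeDeriv] at hG ⊢
  rw [hG]
  have h1 := dirDeriv_mul (e := (0, 1)) (h.diff hf hz) (h.diff hb hz)
  have h2 := dirDeriv_rpow (e := (0, 1)) (h.diff hu hz) h0 (-β)
  rw [h2, Real.rpow_sub_one h0] at h1
  rw [h1]
  ring

end IsLocalFlow

/-! ### Algebra at a maximum point. -/

/-- The inequality which the conditions at a maximum imply for the jet of the speed. Here
`e, e₁, e₂, eₜ` are the cutoff and its derivatives, `u, x, y, w` the speed and its arc length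
derivatives, and `k` is the curvature. -/
theorem gradient_ineq_of_max {α β τ e e₁ e₂ et u x y w k a ut xt : ℝ} (hα : 0 < α)
    (he : 0 < e) (hu : 0 < u) (hk : 0 < k) (hx : x ≠ 0) (hτ : 0 < τ) (ha : a * k = α * u)
    (h1 : e₁ * x + e * (y - β * (x ^ 2 * u⁻¹)) = 0)
    (h2 : x * (e₂ * x + 2 * e₁ * y + e * w -
      β * (e₁ * x ^ 2 * u⁻¹ + 2 * e * x * y * u⁻¹ - e * x ^ 3 * u⁻¹ ^ 2)) ≤ 0)
    (h3 : 0 ≤ x * (e * x + 2 * τ * (et * x + e * (xt - β * (x * ut * u⁻¹)))))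
    (hut : ut = a * (y + k ^ 2 * u))
    (hxt : k * xt = k * a * (w + k ^ 2 * x) + 2 * k ^ 2 * u * x + (α - 1) * x * (y + k ^ 2 * u) +
      k ^ 2 * u * x) :
    β * (α⁻¹ - β) * (e * (x / u)) ^ 2 + (2 * β + (1 - α⁻¹)) * e₁ * (e * (x / u)) ≤
      2 * e₁ ^ 2 - e * e₂ + k ^ 2 * (2 + 2 * α⁻¹ - β) * e ^ 2 +
        k / (α * u) * (e * et) + k * e ^ 2 / (2 * α * τ * u) := by
  -- Logarithmic variables: q = u_s / u, g = e_s / e and W = u_sss / u_s; the critical point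
  -- equation then gives u_ss in terms of q and g.
  obtain ⟨q, rfl⟩ : ∃ q, x = q * u := ⟨x / u, by field_simp⟩
  have hq : q ≠ 0 := fun h => hx (by rw [h, zero_mul])
  obtain ⟨g, rfl⟩ : ∃ g, e₁ = g * e := ⟨e₁ / e, by field_simp⟩
  have hy : y = u * (β * q ^ 2 - g * q) := by
    have : e * (y - u * (β * q ^ 2 - g * q)) = 0 := by
      rw [← h1]; field_simp; ring
    have := (mul_eq_zero.1 this).resolve_left he.ne'
    linarith
  subst hy
  obtain ⟨W, rfl⟩ : ∃ W, w = q * u * W := ⟨w / (q * u), by field_simp⟩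
  have ha' : a = α * u / k := by field_simp; linarith
  subst ha'
  have hxt' : xt = q * u * (α * u / k * (W + k ^ 2) + 2 * k * u +
      (α - 1) * u * (β * q ^ 2 - g * q + k ^ 2) / k + k * u) := by
    apply mul_left_cancel₀ hk.ne'
    rw [hxt]
    field_simp
  subst hxt' hut
  have hp : 0 < (q * u) ^ 2 := by positivity
  have i2 : 0 ≤ -(e₂ + e * (2 * g * (β * q - g) + W -
      β * (g * q + 2 * q * (β * q - g) - q ^ 2))) := by
    refine nonneg_of_mul_nonneg_right (a := (q * u) ^ 2) ?_ hp
    refine le_of_le_of_eq (neg_nonneg.2 h2) ?_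
    field_simp
    ring
  have i3 : 0 ≤ e + 2 * τ * (et + e * ((α * u / k * (W + k ^ 2) + 2 * k * u +
      (α - 1) * u * (β * q ^ 2 - g * q + k ^ 2) / k + k * u) -
      β * (α * u / k * (β * q ^ 2 - g * q + k ^ 2)))) := by
    refine nonneg_of_mul_nonneg_right (a := (q * u) ^ 2) ?_ hp
    refine le_of_le_of_eq h3 ?_
    field_simp
  -- The multipliers `e` and `e * k / (2 * α * τ * u)` are chosen so that the terms -e² W and e² W
  -- cancel in the sum. The q² terms add up to -β (α⁻¹ - β) e² q².
  have i2' := mul_nonneg he.le i2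
  have i3' := mul_nonneg (show 0 ≤ e * k / (2 * α * τ * u) by positivity) i3
  rw [← sub_nonneg]
  refine le_of_le_of_eq (add_nonneg i2' i3') ?_
  field_simp
  ring

/-- Young's inequality absorbs the linear term in half of the quadratic one; the weight (u b)² then
compensates the factor 1/u. It is applied with b = u^(-β) and q u b equal to the localized gradient.
-/
theorem weighted_sq_bound_of_quadratic {c A B Q q k α τ u b S₁ S₂ : ℝ} (hc : 0 < c) (hα : 0 < α)
    (hB : 0 ≤ B) (hτ : 0 < τ) (hu : 0 < u) (hb : 0 < b)
    (hQ : c * Q ^ 2 ≤ A * Q + B + k / (2 * α * τ * u)) (h1 : u * b ≤ S₁)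
    (h2 : k * u * b ^ 2 ≤ S₂) (hq : q ^ 2 = Q ^ 2) :
    τ * (q * u * b) ^ 2 ≤ 2 / c * (A ^ 2 / (2 * c) + B) * S₁ ^ 2 * τ + S₂ / (c * α) := by
  have h3 : A * Q ≤ c * Q ^ 2 / 2 + A ^ 2 / (2 * c) := by
    have : 0 ≤ (c * Q - A) ^ 2 / (2 * c) := by positivity
    have e : (c * Q - A) ^ 2 / (2 * c) = c * Q ^ 2 / 2 + A ^ 2 / (2 * c) - A * Q := by
      field_simp; ring
    linarith
  have h4 : c * Q ^ 2 / 2 ≤ A ^ 2 / (2 * c) + B + k / (2 * α * τ * u) := by linarith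
  have h5 := mul_le_mul_of_nonneg_left h4 (show 0 ≤ 2 * τ * (u * b) ^ 2 / c by positivity)
  have h6 : (u * b) ^ 2 ≤ S₁ ^ 2 := pow_le_pow_left₀ (by positivity) h1 2
  calc τ * (q * u * b) ^ 2 = 2 * τ * (u * b) ^ 2 / c * (c * Q ^ 2 / 2) := by
        rw [mul_assoc q, mul_pow, hq]; field_simp
    _ ≤ _ := h5
    _ = 2 / c * (A ^ 2 / (2 * c) + B) * (u * b) ^ 2 * τ + (k * u * b ^ 2) / (c * α) := by
        field_simp
    _ ≤ _ := by gcongr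

/-- Every term is replaced by a constant, with `K` an upper bound of the curvature, except the
quadratic and linear ones and the term with 1/(τ u), which is unbounded and must be kept. -/
theorem quadratic_ineq_of_gradient_ineq {α β K τ e e₁ e₂ et u q k : ℝ} (hα : 0 < α) (hβ : 0 < β)
    (hβα : β < α⁻¹) (hK0 : 0 < K) (he : 0 < e) (he1 : e ≤ 1) (hu : 0 < u) (hk : 0 < k)
    (hkK : k ≤ K) (hτ : 0 < τ) (b1 : |e₁| ≤ 2) (b2 : |e₂| ≤ 2 * (1 + K)) (b3 : |et| ≤ 2 * u)
    (main : β * (α⁻¹ - β) * q ^ 2 + (2 * β + (1 - α⁻¹)) * e₁ * q ≤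
      2 * e₁ ^ 2 - e * e₂ + k ^ 2 * (2 + 2 * α⁻¹ - β) * e ^ 2 +
        k / (α * u) * (e * et) + k * e ^ 2 / (2 * α * τ * u)) :
    β * (α⁻¹ - β) * |q| ^ 2 ≤ 2 * |2 * β + (1 - α⁻¹)| * |q| +
      (8 + 2 * (1 + K) + K ^ 2 * (2 + 2 * α⁻¹) + 2 * K / α) + k / (2 * α * τ * u) := by
  have hαi : 0 < α⁻¹ := inv_pos.2 hα
  rw [sq_abs]
  have t1 : -((2 * β + (1 - α⁻¹)) * e₁ * q) ≤ 2 * |2 * β + (1 - α⁻¹)| * |q| := by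
    refine (neg_le_abs _).trans ?_
    rw [abs_mul, abs_mul]
    refine mul_le_mul_of_nonneg_right ?_ (abs_nonneg _)
    exact (mul_le_mul_of_nonneg_left b1 (abs_nonneg _)).trans_eq (mul_comm _ _)
  have t2 : 2 * e₁ ^ 2 ≤ 8 := by
    have := sq_le_sq' (by linarith [neg_abs_le e₁]) ((le_abs_self e₁).trans b1)
    linarith
  have t3 : -(e * e₂) ≤ 2 * (1 + K) := by
    refine (neg_le_abs _).trans ?_
    rw [abs_mul, abs_of_pos he]
    calc e * |e₂| ≤ 1 * (2 * (1 + K)) := mul_le_mul he1 b2 (abs_nonneg _) zero_le_one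
      _ = _ := one_mul _
  have he2 : e ^ 2 ≤ 1 := pow_le_one₀ he.le he1
  have t4 : k ^ 2 * (2 + 2 * α⁻¹ - β) * e ^ 2 ≤ K ^ 2 * (2 + 2 * α⁻¹) := by
    have i1 : k ^ 2 * (2 + 2 * α⁻¹ - β) ≤ K ^ 2 * (2 + 2 * α⁻¹) :=
      mul_le_mul (pow_le_pow_left₀ hk.le hkK 2) (by linarith) (by linarith) (by positivity)
    calc _ ≤ K ^ 2 * (2 + 2 * α⁻¹) * 1 :=
          mul_le_mul i1 he2 (by positivity) (by positivity)
      _ = _ := mul_one _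
  have t5 : k / (α * u) * (e * et) ≤ 2 * K / α := by
    have i1 : e * et ≤ 1 * (2 * u) := by
      refine (le_abs_self _).trans ?_
      rw [abs_mul, abs_of_pos he]
      exact mul_le_mul he1 b3 (abs_nonneg _) zero_le_one
    calc k / (α * u) * (e * et) ≤ k / (α * u) * (1 * (2 * u)) := by gcongr
      _ = 2 * k / α := by field_simp
      _ ≤ _ := by gcongr
  have t6 : k * e ^ 2 / (2 * α * τ * u) ≤ k / (2 * α * τ * u) := by
    gcongr
    exact mul_le_of_le_one_right hk.le he2
  linarith

/-! ### The bound at a maximum point in space-time. -/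

namespace IsLocalFlow

theorem flowSpeed_eq {α : ℝ} {U : Set (ℝ × ℝ)} {X : ℝ × ℝ → Plane} {z : ℝ × ℝ} (hα : 0 < α)
    (h : IsLocalFlow α U X) (hz : z ∈ U) :
    familyCurvature X z = flowSpeed α X z ^ α⁻¹ ∧
      diffusivity α X z * familyCurvature X z = α * flowSpeed α X z := by
  have hk := h.curvature_pos hz
  constructor
  · rw [flowSpeed, ← Real.rpow_mul hk.le, mul_inv_cancel₀ hα.ne', Real.rpow_one]
  · rw [diffusivity, flowSpeed, mul_assoc, ← Real.rpow_add_one hk.ne', sub_add_cancel]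

/-- The bound for the localized gradient at a maximum point in space-time. -/
theorem exists_localGradient_bound {α β M : ℝ} (hα : 0 < α) (hβ : 0 < β) (hβ1 : β < 1)
    (hβα : β < α⁻¹) (hM : 1 ≤ M) :
    ∃ C, 0 ≤ C ∧ ∀ (r a p t : ℝ) (U : Set (ℝ × ℝ)) (X : ℝ × ℝ → Plane), IsLocalFlow α U X →
      (p, t) ∈ U → r ^ 2 ≤ 1 → 0 < cutoff r X (p, t) → a < t → flowSpeed α X (p, t) ≤ M →
      (∀ᶠ q in 𝓝 p, localGradient α β r X (q, t) ^ 2 ≤ localGradient α β r X (p, t) ^ 2) →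
      (∀ᶠ τ in 𝓝[<] t, (τ - a) * localGradient α β r X (p, τ) ^ 2 ≤
        (t - a) * localGradient α β r X (p, t) ^ 2) →
      (t - a) * localGradient α β r X (p, t) ^ 2 ≤ C * (1 + (t - a)) := by
  set K := M ^ α⁻¹ with hK
  set c := β * (α⁻¹ - β) with hc
  set A := 2 * |2 * β + (1 - α⁻¹)| with hA
  set B := 8 + 2 * (1 + K) + K ^ 2 * (2 + 2 * α⁻¹) + 2 * K / α with hB
  set C₁ := 2 / c * (A ^ 2 / (2 * c) + B) * (M ^ (1 - β)) ^ 2 with hC₁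
  set C₂ := M ^ (α⁻¹ + 1 - 2 * β) / (c * α) with hC₂
  have hM0 : 0 < M := by linarith
  have hc0 : 0 < c := mul_pos hβ (by linarith)
  have hK0 : 0 < K := Real.rpow_pos_of_pos hM0 _
  have hαi : 0 < α⁻¹ := inv_pos.2 hα
  have hB0 : 0 ≤ B := by positivity
  have hC₁0 : 0 ≤ C₁ := by positivity
  have hC₂0 : 0 ≤ C₂ := by positivity
  refine ⟨C₁ + C₂, by positivity, ?_⟩
  intro r a p t U X h hz hr he hat huM hsp htm
  have hτ : 0 < t - a := by linarith
  by_cases hx : lengthDeriv X (flowSpeed α X) (p, t) = 0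
  · have : localGradient α β r X (p, t) = 0 := by rw [localGradient, hx]; ring
    rw [this]
    simp only [ne_eq, OfNat.ofNat_ne_zero, not_false_eq_true, zero_pow, mul_zero]
    positivity
  have hu := h.flowSpeed_pos hz
  have hk := h.curvature_pos hz
  obtain ⟨hku, ha⟩ := h.flowSpeed_eq hα hz
  have hbpos : 0 < flowSpeed α X (p, t) ^ (-β) := Real.rpow_pos_of_pos hu _
  have hGne : localGradient α β r X (p, t) ≠ 0 :=
    mul_ne_zero he.ne' (mul_ne_zero hx hbpos.ne')
  have hG := h.contDiffOn_localGradient (β := β) (r := r)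
  obtain ⟨g1, g2⟩ := h.lengthDeriv_eq_zero_of_isLocalMax_sq hG hz hGne hsp
  have g3 := h.timeDeriv_of_left_max hG hz htm
  rw [h.lengthDeriv_lengthDeriv_localGradient hz g1] at g2
  rw [h.lengthDeriv_localGradient hz] at g1
  replace g1 := (mul_eq_zero.1 g1).resolve_left hbpos.ne'
  rw [h.timeDeriv_localGradient hz] at g3
  have e1 := h.lengthDeriv_cutoff (r := r) hz
  have e2 := h.lengthDeriv_lengthDeriv_cutoff (r := r) hz
  have e3 := h.timeDeriv_cutoff (r := r) hz
  have hxt := h.timeDeriv_lengthDeriv_flowSpeed hz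
  have hut := h.timeDeriv_flowSpeed hz
  have hX : ‖X (p, t)‖ ≤ 1 := by
    have : cutoff r X (p, t) = r ^ 2 - ‖X (p, t)‖ ^ 2 := by
      rw [cutoff, real_inner_self_eq_norm_sq]
    exact (sq_le_one_iff₀ (norm_nonneg _)).1 (by linarith)
  have hinner : ∀ v : Plane, inner ℝ v v = (1 : ℝ) → |inner ℝ (X (p, t)) v| ≤ 1 := by
    intro v hv
    have hv1 : ‖v‖ = 1 := by
      rw [real_inner_self_eq_norm_sq] at hv
      exact (pow_eq_one_iff_of_nonneg (norm_nonneg v) two_ne_zero).1 hv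
    have := abs_real_inner_le_norm (X (p, t)) v
    rw [hv1, mul_one] at this
    exact this.trans hX
  have hT := hinner _ (h.inner_tangent_tangent hz)
  have hN := hinner _ (h.inner_normal_normal hz)
  have he1 : cutoff r X (p, t) ≤ 1 := by
    have : 0 ≤ inner ℝ (X (p, t)) (X (p, t)) := real_inner_self_nonneg
    rw [cutoff]; linarith
  have hkK : familyCurvature X (p, t) ≤ K := by
    rw [hku, hK]; exact Real.rpow_le_rpow hu.le huM hαi.le
  have hS1 : flowSpeed α X (p, t) * flowSpeed α X (p, t) ^ (-β) ≤ M ^ (1 - β) := by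
    have : flowSpeed α X (p, t) * flowSpeed α X (p, t) ^ (-β) = flowSpeed α X (p, t) ^ (1 - β) := by
      rw [sub_eq_add_neg, Real.rpow_add hu, Real.rpow_one]
    rw [this]
    exact Real.rpow_le_rpow hu.le huM (by linarith)
  -- Since κ = u^(1/α), the exponent is (1/α - β) + (1 - β) > 0, so the power of u is monotone.
  have hS2 : familyCurvature X (p, t) * flowSpeed α X (p, t) *
      (flowSpeed α X (p, t) ^ (-β)) ^ 2 ≤ M ^ (α⁻¹ + 1 - 2 * β) := by
    have : familyCurvature X (p, t) * flowSpeed α X (p, t) *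
        (flowSpeed α X (p, t) ^ (-β)) ^ 2 = flowSpeed α X (p, t) ^ (α⁻¹ + 1 - 2 * β) := by
      rw [hku, ← Real.rpow_add_one hu.ne', pow_two, ← Real.rpow_add hu,
        ← Real.rpow_add hu]
      congr 1; ring
    rw [this]
    exact Real.rpow_le_rpow hu.le huM (by linarith)
  have hGx : localGradient α β r X (p, t) = cutoff r X (p, t) *
    (lengthDeriv X (flowSpeed α X) (p, t) * flowSpeed α X (p, t) ^ (-β)) := rfl
  rw [hGx] at g2 g3 ⊢
  clear_value K c A B C₁ C₂
  generalize lengthDeriv X (lengthDeriv X (lengthDeriv X (flowSpeed α X))) (p, t) = w at *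
  generalize lengthDeriv X (lengthDeriv X (flowSpeed α X)) (p, t) = y at *
  generalize timeDeriv (lengthDeriv X (flowSpeed α X)) (p, t) = xt at *
  generalize lengthDeriv X (flowSpeed α X) (p, t) = x at *
  generalize timeDeriv (flowSpeed α X) (p, t) = ut at *
  generalize diffusivity α X (p, t) = a at *
  generalize familyCurvature X (p, t) = k at *
  generalize lengthDeriv X (lengthDeriv X (cutoff r X)) (p, t) = e₂ at *
  generalize lengthDeriv X (cutoff r X) (p, t) = e₁ at *
  generalize timeDeriv (cutoff r X) (p, t) = et at *
  generalize cutoff r X (p, t) = e at *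
  generalize flowSpeed α X (p, t) ^ (-β) = b at *
  generalize flowSpeed α X (p, t) = u at *
  generalize (inner ℝ (X (p, t)) (unitTangent X (p, t)) : ℝ) = XT at *
  generalize (inner ℝ (X (p, t)) (principalNormal X (p, t)) : ℝ) = XN at *
  generalize t - _ = τ at *
  -- The common positive factor of G G_ss and of the time inequality, divided out before the
  -- algebraic lemma applies.
  have heb : 0 < e * b ^ 2 := by positivity
  have main := gradient_ineq_of_max hα he hu hk hx hτ ha g1 (e₂ := e₂) (w := w) (et := et)
    (xt := xt) (ut := ut)
    (by
      have : 0 ≤ e * b ^ 2 * -(x * (e₂ * x + 2 * e₁ * y + e * w -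
          β * (e₁ * x ^ 2 * u⁻¹ + 2 * e * x * y * u⁻¹ - e * x ^ 3 * u⁻¹ ^ 2))) := by
        linarith
      linarith [nonneg_of_mul_nonneg_right this heb])
    (by
      refine nonneg_of_mul_nonneg_right (a := e * b ^ 2) ?_ heb
      linarith) hut hxt
  have b1 : |e₁| ≤ 2 := by rw [e1, abs_mul, abs_neg, abs_two]; linarith
  have b2 : |e₂| ≤ 2 * (1 + K) := by
    rw [e2, abs_mul, abs_neg, abs_two]
    have h1 : |1 + k * XN| ≤ 1 + k * |XN| := by
      have := abs_add_le 1 (k * XN)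
      rwa [abs_one, abs_mul, abs_of_pos hk] at this
    have h2 : k * |XN| ≤ K * 1 := mul_le_mul hkK hN (abs_nonneg _) hK0.le
    linarith
  have b3 : |et| ≤ 2 * u := by
    rw [e3, abs_mul, abs_neg, abs_two, abs_mul, abs_of_pos hu]
    have := mul_le_mul_of_nonneg_left hN hu.le
    linarith
  have hQ : c * |e * (x / u)| ^ 2 ≤ A * |e * (x / u)| + B + k / (2 * α * τ * u) := by
    rw [hc, hA, hB]
    exact quadratic_ineq_of_gradient_ineq hα hβ hβα hK0 he he1 hu hk hkK hτ b1 b2 b3 main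
  have fin := weighted_sq_bound_of_quadratic hc0 hα hB0 hτ hu hbpos hQ hS1 hS2 (sq_abs _).symm
  rw [← hC₁, ← hC₂] at fin
  have : e * (x / u) * u * b = e * (x * b) := by field_simp
  rw [this] at fin
  have i1 := mul_nonneg hC₂0 hτ.le
  linarith

end IsLocalFlow

/-! ### Properness of convex complete curves. -/

/-- A ray from an interior point of a convex set meets the frontier at most once. -/
theorem eq_of_mem_frontier_of_ray {E : Type*} [NormedAddCommGroup E] [NormedSpace ℝ E]
    {K : Set E} (hK : Convex ℝ K) {o y z : E} (ho : o ∈ interior K) (hy : y ∈ frontier K)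
    (hz : z ∈ frontier K) {c : ℝ} (hc : 0 < c) (h : z - o = c • (y - o)) : z = y := by
  have key : ∀ {y z : E} {c : ℝ}, y ∈ frontier K → z ∈ frontier K → 0 < c →
      z - o = c • (y - o) → ¬ c < 1 := by
    intro y z c hy hz hc h hc1
    apply hz.2
    have : z = (1 - c) • o + c • y := by
      rw [← sub_add_cancel z o, h]; module
    rw [this]
    exact hK.combo_interior_closure_mem_interior ho hy.1 (by linarith) hc.le (by ring)
  have h1 := key hy hz hc h
  have h2 := key hz hy (inv_pos.2 hc) (by rw [h, smul_smul, inv_mul_cancel₀ hc.ne', one_smul])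
  have : c = 1 := by
    rw [inv_lt_one₀ hc] at h2
    linarith
  rw [this, one_smul] at h
  exact sub_left_injective h

/-- In the frame formed by `a` and its rotation by a right angle, the slope determines a ray in the
half-plane ⟨a, ·⟩ > 0: equal slopes make the determinant of `Y` and `Z` vanish. -/
theorem eq_smul_of_slope_eq {a Y Z : Plane} (hY : 0 < a 0 * Y 0 + a 1 * Y 1)
    (hZ : 0 < a 0 * Z 0 + a 1 * Z 1)
    (h : (a 0 * Y 1 - a 1 * Y 0) / (a 0 * Y 0 + a 1 * Y 1) =
      (a 0 * Z 1 - a 1 * Z 0) / (a 0 * Z 0 + a 1 * Z 1)) :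
    Z = ((a 0 * Z 0 + a 1 * Z 1) / (a 0 * Y 0 + a 1 * Y 1)) • Y := by
  rw [div_eq_div_iff hY.ne' hZ.ne'] at h
  have ha : 0 < a 0 ^ 2 + a 1 ^ 2 := by
    by_contra! hn
    have h0 : a 0 = 0 := by nlinarith [sq_nonneg (a 0), sq_nonneg (a 1)]
    have h1 : a 1 = 0 := by nlinarith [sq_nonneg (a 0), sq_nonneg (a 1)]
    simp [h0, h1] at hY
  have hdet : Z 0 * Y 1 = Z 1 * Y 0 := by
    apply mul_left_cancel₀ ha.ne'
    linear_combination h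
  ext i
  fin_cases i
  · simp only [Fin.zero_eta, PiLp.smul_apply, smul_eq_mul]
    rw [div_mul_eq_mul_div, eq_div_iff hY.ne']
    linear_combination a 1 * hdet
  · simp only [Fin.mk_one, PiLp.smul_apply, smul_eq_mul]
    rw [div_mul_eq_mul_div, eq_div_iff hY.ne']
    linear_combination -a 0 * hdet

/-- An injective parametrization of the frontier of a convex set does not return to a point of the
curve from infinity. -/
theorem ParametrizesBoundary.exists_nhds_isBounded_preimage {γ : ℝ → Plane} {K : Set Plane}
    (hK : Convex ℝ K) (h : ParametrizesBoundary γ K) (q : ℝ) :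
    ∃ N ∈ 𝓝 (γ q), Bornology.IsBounded (γ ⁻¹' N) := by
  obtain ⟨o, ho⟩ := h.interior_nonempty
  have hfr : ∀ p, γ p ∈ frontier K := fun p => h.frontier_eq ▸ mem_range_self p
  have hγ : Continuous γ := h.smooth.continuous
  set a : Plane := γ q - o with ha
  set m : Plane → ℝ := fun y => a 0 * (y - o) 0 + a 1 * (y - o) 1 with hm
  set l : Plane → ℝ := fun y => a 0 * (y - o) 1 - a 1 * (y - o) 0 with hl
  have hmc : Continuous m := by fun_prop
  have hlc : Continuous l := by fun_prop
  have hane : a ≠ 0 := fun h0 => (hfr q).2 (by rwa [sub_eq_zero.1 h0])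
  have hmq : 0 < m (γ q) := by
    have : m (γ q) = inner ℝ a a := by
      simp only [hm, PiLp.inner_apply, Fin.sum_univ_two, RCLike.inner_apply, conj_trivial]
      rw [← ha]
    rw [this]
    exact real_inner_self_pos.2 hane
  have hlq : l (γ q) = 0 := by
    simp only [hl, ← ha]; ring
  -- The slope l / m labels the rays from `o` in a half-plane; as each ray meets the frontier at
  -- most once, it separates the parameters of the curve there.
  have huniq : ∀ p p', 0 < m (γ p) → 0 < m (γ p') → l (γ p) / m (γ p) = l (γ p') / m (γ p') →
      p = p' := fun p p' hp hp' he =>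
    (h.injective (eq_of_mem_frontier_of_ray hK ho (hfr p) (hfr p') (div_pos hp' hp)
      (eq_smul_of_slope_eq hp hp' he))).symm
  obtain ⟨δ, hδ, hball⟩ := Metric.mem_nhds_iff.1
    ((hmc.comp hγ).continuousAt.preimage_mem_nhds (Ioi_mem_nhds hmq))
  have hIcc : ∀ p ∈ Icc (q - δ / 2) (q + δ / 2), 0 < m (γ p) := fun p hp =>
    hball (by rw [Metric.mem_ball, Real.dist_eq, abs_lt]; constructor <;> linarith [hp.1, hp.2])
  set f : ℝ → ℝ := fun p => l (γ p) / m (γ p) with hf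
  have hfc : ContinuousOn f (Icc (q - δ / 2) (q + δ / 2)) :=
    (hlc.comp hγ).continuousOn.div (hmc.comp hγ).continuousOn fun p hp => (hIcc p hp).ne'
  have hfi : InjOn f (Icc (q - δ / 2) (q + δ / 2)) := fun p hp p' hp' he =>
    huniq p p' (hIcc p hp) (hIcc p' hp') he
  have hfq : f q = 0 := by simp only [hf, hlq, zero_div]
  have hleft : q - δ / 2 ∈ Icc (q - δ / 2) (q + δ / 2) := ⟨le_rfl, by linarith⟩
  have hright : q + δ / 2 ∈ Icc (q - δ / 2) (q + δ / 2) := ⟨by linarith, le_rfl⟩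
  have hmid : q ∈ Icc (q - δ / 2) (q + δ / 2) := ⟨by linarith, by linarith⟩
  -- A continuous injective function on an interval is strictly monotone, so parameters near `q`
  -- already realize all slopes near 0.
  have hnhds : f '' Icc (q - δ / 2) (q + δ / 2) ∈ 𝓝 (0 : ℝ) := by
    rw [← hfq]
    rcases hfc.strictMonoOn_of_injOn_Icc' (by linarith) hfi with hmono | hanti
    · exact mem_of_superset (Icc_mem_nhds (hmono hleft hmid (by linarith))
        (hmono hmid hright (by linarith))) (intermediate_value_Icc (by linarith) hfc)
    · exact mem_of_superset (Icc_mem_nhds (hanti hmid hright (by linarith))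
        (hanti hleft hmid (by linarith))) (intermediate_value_Icc' (by linarith) hfc)
  have hρ : ContinuousAt (fun y => l y / m y) (γ q) :=
    hlc.continuousAt.div hmc.continuousAt hmq.ne'
  -- The neighbourhood is the sector of these slopes; by uniqueness, any parameter sent into it lies
  -- in the compact interval.
  refine ⟨{y | 0 < m y} ∩ (fun y => l y / m y) ⁻¹' (f '' Icc (q - δ / 2) (q + δ / 2)),
    inter_mem (hmc.continuousAt.preimage_mem_nhds (Ioi_mem_nhds hmq))
      (hρ.preimage_mem_nhds (by rwa [hlq, zero_div])), ?_⟩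
  refine (Metric.isBounded_Icc (q - δ / 2) (q + δ / 2)).subset ?_
  rintro p ⟨hp, p', hp', he⟩
  rwa [← huniq p' p (hIcc p' hp') hp he]

/-- An injective parametrization of the frontier of a convex set is proper. -/
theorem IsConvexCompleteCurve.isBounded_preimage {γ : ℝ → Plane} (h : IsConvexCompleteCurve γ)
    (R : ℝ) : Bornology.IsBounded {p | ‖γ p‖ ≤ R} := by
  obtain ⟨K, hK, hγ⟩ := h
  have : {p | ‖γ p‖ ≤ R} = γ ⁻¹' Metric.closedBall 0 R := by ext p; simp
  rw [this]
  refine (isCompact_closedBall (0 : Plane) R).induction_on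
    (p := fun s => Bornology.IsBounded (γ ⁻¹' s)) (by simp)
    (fun s t hst ht => ht.subset (preimage_mono hst))
    (fun s t hs ht => by rw [preimage_union]; exact hs.union ht) ?_
  intro x _
  by_cases hx : x ∈ range γ
  · obtain ⟨q, rfl⟩ := hx
    obtain ⟨N, hN, hb⟩ := hγ.exists_nhds_isBounded_preimage hK q
    exact ⟨N, mem_nhdsWithin_of_mem_nhds hN, hb⟩
  · refine ⟨(range γ)ᶜ, mem_nhdsWithin_of_mem_nhds ?_, ?_⟩
    · rw [← hγ.frontier_eq] at hx ⊢
      exact isClosed_frontier.isOpen_compl.mem_nhds hx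
    · have : γ ⁻¹' (range γ)ᶜ = ∅ := by ext p; simp
      rw [this]
      exact Bornology.isBounded_empty

/-! ### Compactness in space-time. -/

section Region

variable {α L : ℝ} {X : ℝ → ℝ → Plane}

theorem speed_nonneg (p t : ℝ) : 0 ≤ speed α X p t := Real.rpow_nonneg (norm_nonneg _) _

/-- A point of a solution with bounded speed in the unit ball stays in the ball for some time. -/
theorem IsConvexCompleteSolution.norm_le_of_speed_le (hX : IsConvexCompleteSolution α X)
    (hL : ∀ p t, 0 ≤ t → X p t ∈ Metric.ball (0 : Plane) 1 → speed α X p t ≤ L)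
    {p t s r : ℝ} (ht : 0 < t) (hts : t ≤ s) (hr : ‖X p t‖ ≤ r)
    (hs : r + (L + 1) * (s - t) < 1) (hL0 : 0 ≤ L) : ‖X p s‖ ≤ r + (L + 1) * (s - t) := by
  have hd : ∀ x, 0 < x → ∃ v : Plane, ‖v‖ = speed α X p x ∧ HasDerivAt (fun τ => X p τ) v x := by
    intro x hx
    obtain ⟨n, hn, hv⟩ := hX.flow p x hx
    refine ⟨_, ?_, hv⟩
    rw [norm_smul, hn.norm_eq_one, mul_one, Real.norm_of_nonneg (speed_nonneg p x)]
  choose! v hv hdv using hd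
  -- The barrier has slope `L + 1` because the comparison requires strict inequality where the norm
  -- meets it; there the barrier is below 1, so the speed is at most `L`.
  refine image_norm_le_of_norm_deriv_right_lt_deriv_boundary
    (f := fun τ => X p τ) (f' := v) (a := t) (b := s) (B := fun x => r + (L + 1) * (x - t))
    (B' := fun _ => L + 1)
    (fun x hx => (hdv x (ht.trans_le hx.1)).continuousAt.continuousWithinAt)
    (fun x hx => (hdv x (ht.trans_le hx.1)).hasDerivWithinAt) (by simpa using hr) ?_ ?_
    ⟨hts, le_rfl⟩
  · intro x
    simpa using (((hasDerivAt_id x).sub_const t).const_mul (L + 1)).const_add r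
  · intro x hx he
    have h0 : 0 < x := ht.trans_le hx.1
    have hx1 : ‖X p x‖ < 1 := by
      rw [he]
      have : (L + 1) * (x - t) ≤ (L + 1) * (s - t) :=
        mul_le_mul_of_nonneg_left (by linarith [hx.2]) (by linarith)
      linarith
    rw [hv x h0]
    linarith [hL p x h0.le (by simpa using hx1)]

/-- The part of a solution with bounded speed inside a ball is compact in space-time. -/
theorem IsConvexCompleteSolution.isCompact_region (hX : IsConvexCompleteSolution α X)
    (hL : ∀ p t, 0 ≤ t → X p t ∈ Metric.ball (0 : Plane) 1 → speed α X p t ≤ L) (hL0 : 0 ≤ L)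
    {a b r : ℝ} (ha : 0 < a) (hr : r < 1) :
    IsCompact {z : ℝ × ℝ | z.2 ∈ Icc a b ∧ ‖X z.1 z.2‖ ≤ r} := by
  apply Metric.isCompact_of_isClosed_isBounded
  · have hc : ContinuousOn (fun z : ℝ × ℝ => ‖X z.1 z.2‖) (univ ×ˢ Icc a b) :=
      (hX.continuous.mono (prod_mono le_rfl fun t ht => ha.le.trans ht.1)).norm
    have := hc.preimage_isClosed_of_isClosed (isClosed_univ.prod isClosed_Icc)
      (isClosed_Iic (a := r))
    have e : {z : ℝ × ℝ | z.2 ∈ Icc a b ∧ ‖X z.1 z.2‖ ≤ r} =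
        univ ×ˢ Icc a b ∩ (fun z => ‖X z.1 z.2‖) ⁻¹' Iic r := by
      ext z
      simp
    rwa [e]
  -- During a time `δ` a point of the region moves by at most (1 - r)/2, so it is still in the unit
  -- ball at the next grid time a + j δ. Its parameter thus belongs to one of finitely many bounded
  -- sets. The last grid time may exceed `b`.
  · set δ := (1 - r) / (2 * (L + 1)) with hδ
    have hL1 : 0 < L + 1 := by linarith
    have hδ0 : 0 < δ := div_pos (by linarith) (by linarith)
    have hLδ : (L + 1) * δ = (1 - r) / 2 := by rw [hδ]; field_simp
    set N := ⌈(b - a) / δ⌉₊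
    have hb : Bornology.IsBounded (⋃ j ∈ Finset.range (N + 1), {p | ‖X p (a + j * δ)‖ ≤ 1}) := by
      rw [Bornology.isBounded_biUnion_finset]
      intro j _
      exact (hX.convex_complete _ (by positivity)).isBounded_preimage 1
    refine (hb.prod (Metric.isBounded_Icc a b)).subset ?_
    rintro ⟨p, t⟩ ⟨ht, hp⟩
    refine ⟨?_, ht⟩
    simp only [mem_iUnion, mem_ofPred_eq]
    have h0 : 0 ≤ (t - a) / δ := div_nonneg (by linarith [ht.1]) hδ0.le
    have h1 := Nat.le_ceil ((t - a) / δ)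
    have h2 := Nat.ceil_lt_add_one h0
    rw [div_le_iff₀ hδ0] at h1
    have h3 : (⌈(t - a) / δ⌉₊ : ℝ) * δ < (t - a) + δ := by
      have := mul_lt_mul_of_pos_right h2 hδ0
      rwa [add_mul, div_mul_cancel₀ _ hδ0.ne', one_mul] at this
    refine ⟨⌈(t - a) / δ⌉₊, Finset.mem_range.2 (Nat.lt_succ_of_le (Nat.ceil_mono ?_)), ?_⟩
    · gcongr
      exact ht.2
    · have h4 : (L + 1) * (a + ⌈(t - a) / δ⌉₊ * δ - t) ≤ (L + 1) * δ :=
        mul_le_mul_of_nonneg_left (by linarith) hL1.le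
      exact (hX.norm_le_of_speed_le hL (ha.trans_le ht.1) (by linarith) hp (by linarith)
        hL0).trans (by linarith)

end Region

/-! ### Convex complete solutions as local flows, and the gradient estimate. -/

section Solution

variable {α : ℝ} {X : ℝ → ℝ → Plane}

/-- A unit normal vector `n` with `⟨n, Y⟩ ≥ 0` is the normalization of the vector `Y`, if `Y` is
also normal. -/
theorem inv_norm_smul_eq_of_orthogonal {n T Y : Plane} (hn : ‖n‖ = 1) (hT : ‖T‖ = 1)
    (hnT : inner ℝ n T = 0) (hYT : inner ℝ T Y = 0) (hY : Y ≠ 0) (h : 0 ≤ inner ℝ Y n) :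
    ‖Y‖⁻¹ • Y = n := by
  have h1 : Y = inner ℝ Y n • n := eq_inner_smul_of_orthogonal
    (by rw [real_inner_self_eq_norm_sq, hT, one_pow])
    (by rw [real_inner_self_eq_norm_sq, hn, one_pow]) (by rwa [real_inner_comm]) hYT
  have h2 : ‖Y‖ = inner ℝ Y n := by
    conv_lhs => rw [h1]
    rw [norm_smul, hn, mul_one, Real.norm_of_nonneg h]
  rw [← h2] at h1
  calc ‖Y‖⁻¹ • Y = ‖Y‖⁻¹ • (‖Y‖ • n) := by rw [← h1]
    _ = n := by rw [smul_smul, inv_mul_cancel₀ (norm_ne_zero_iff.2 hY), one_smul]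

theorem arcDeriv_eq_lengthDeriv {F : Type*} [NormedAddCommGroup F] [NormedSpace ℝ F]
    {f : ℝ × ℝ → F} {p t : ℝ}
    (hX : DifferentiableAt ℝ (fun z : ℝ × ℝ => X z.1 z.2) (p, t))
    (hf : DifferentiableAt ℝ f (p, t)) :
    arcDeriv (fun q => X q t) (fun q => f (q, t)) p =
      lengthDeriv (fun z : ℝ × ℝ => X z.1 z.2) f (p, t) := by
  have h1 : deriv (fun q => X q t) p = _ := (hasDerivAt_fst hX).deriv
  rw [arcDeriv, (hasDerivAt_fst hf).deriv, h1, lengthDeriv, paramSpeed]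

namespace IsConvexCompleteSolution

theorem isOpen_pos : IsOpen ((univ : Set ℝ) ×ˢ Ioi (0 : ℝ)) := isOpen_univ.prod isOpen_Ioi

theorem differentiableAt (hX : IsConvexCompleteSolution α X) {z : ℝ × ℝ} (hz : 0 < z.2) :
    DifferentiableAt ℝ (fun z : ℝ × ℝ => X z.1 z.2) z :=
  differentiableAt_of_contDiffOn isOpen_pos hX.smooth ⟨mem_univ _, hz⟩

theorem paramDeriv_ne_zero (hX : IsConvexCompleteSolution α X) {z : ℝ × ℝ} (hz : 0 < z.2) :
    paramDeriv (fun z : ℝ × ℝ => X z.1 z.2) z ≠ 0 := by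
  obtain ⟨K, _, h⟩ := hX.convex_complete z.2 hz.le
  have h1 : deriv (fun q => X q z.2) z.1 = _ :=
    (hasDerivAt_fst (p := z.1) (t := z.2) (hX.differentiableAt hz)).deriv
  have := h.regular z.1
  rwa [h1] at this

theorem contDiffOn_paramSpeed (hX : IsConvexCompleteSolution α X) :
    ContDiffOn ℝ ∞ (paramSpeed fun z : ℝ × ℝ => X z.1 z.2) (univ ×ˢ Ioi 0) :=
  (contDiffOn_dirDeriv isOpen_pos hX.smooth _).norm ℝ fun _ hz => hX.paramDeriv_ne_zero hz.2

theorem contDiffOn_unitTangent (hX : IsConvexCompleteSolution α X) :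
    ContDiffOn ℝ ∞ (unitTangent fun z : ℝ × ℝ => X z.1 z.2) (univ ×ˢ Ioi 0) :=
  (hX.contDiffOn_paramSpeed.inv fun _ hz => norm_ne_zero_iff.2 (hX.paramDeriv_ne_zero hz.2)).smul
    (contDiffOn_dirDeriv isOpen_pos hX.smooth _)

theorem speed_eq_flowSpeed (hX : IsConvexCompleteSolution α X) {t : ℝ} (ht : 0 < t) (p : ℝ) :
    speed α X p t = flowSpeed α (fun z : ℝ × ℝ => X z.1 z.2) (p, t) := by
  have h1 : arcDeriv (fun q => X q t) (fun q => X q t) =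
      fun q => unitTangent (fun z : ℝ × ℝ => X z.1 z.2) (q, t) := by
    funext q
    exact arcDeriv_eq_lengthDeriv (hX.differentiableAt (z := (q, t)) ht)
      (hX.differentiableAt (z := (q, t)) ht)
  rw [speed, curvature, h1, arcDeriv_eq_lengthDeriv (hX.differentiableAt (z := (p, t)) ht)
    (differentiableAt_of_contDiffOn isOpen_pos hX.contDiffOn_unitTangent ⟨mem_univ _, ht⟩)]
  rfl

theorem norm_unitTangent (hX : IsConvexCompleteSolution α X) {z : ℝ × ℝ} (hz : 0 < z.2) :
    ‖unitTangent (fun z : ℝ × ℝ => X z.1 z.2) z‖ = 1 := by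
  rw [unitTangent, lengthDeriv, norm_smul, norm_inv, paramSpeed, norm_norm]
  exact inv_mul_cancel₀ (norm_ne_zero_iff.2 (hX.paramDeriv_ne_zero hz))

/-- Where the curvature does not vanish, the inward normal is the principal normal. -/
theorem principalNormal_eq (hX : IsConvexCompleteSolution α X) {p t : ℝ} (ht : 0 < t) {n : Plane}
    (hn : IsInwardUnitNormal (fun q => X q t) p n)
    (hY : lengthDeriv (fun z : ℝ × ℝ => X z.1 z.2)
      (unitTangent fun z : ℝ × ℝ => X z.1 z.2) (p, t) ≠ 0) :
    principalNormal (fun z : ℝ × ℝ => X z.1 z.2) (p, t) = n := by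
  set Y := fun z : ℝ × ℝ => X z.1 z.2 with hYdef
  have hz : (p, t) ∈ (univ : Set ℝ) ×ˢ Ioi (0 : ℝ) := ⟨mem_univ _, ht⟩
  have hv : 0 < paramSpeed Y (p, t) := norm_pos_iff.2 (hX.paramDeriv_ne_zero ht)
  have hTd := differentiableAt_of_contDiffOn isOpen_pos hX.contDiffOn_unitTangent hz
  have hvd := differentiableAt_of_contDiffOn isOpen_pos hX.contDiffOn_paramSpeed hz
  have hXd := hX.differentiableAt (z := (p, t)) ht
  have hnT : inner ℝ n (unitTangent Y (p, t)) = (0 : ℝ) := by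
    have h1 : deriv (fun q => X q t) p = _ := (hasDerivAt_fst hXd).deriv
    have := hn.orthogonal
    rw [h1] at this
    rw [unitTangent, lengthDeriv, inner_smul_right, paramDeriv, this, mul_zero]
  have hTT : inner ℝ (unitTangent Y (p, t)) (lengthDeriv Y (unitTangent Y) (p, t)) = (0 : ℝ) := by
    have h2 := dirDeriv_inner (e := (1, 0)) hTd hTd
    rw [dirDeriv_congr isOpen_pos (g := fun _ => (1 : ℝ)) (fun y hy => by
        rw [real_inner_self_eq_norm_sq, hX.norm_unitTangent hy.2, one_pow]) hz, dirDeriv_const,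
      real_inner_comm (unitTangent Y (p, t)) (dirDeriv _ _ _)] at h2
    rw [lengthDeriv, inner_smul_right, paramDeriv]
    rw [show inner ℝ (unitTangent Y (p, t)) (dirDeriv (1, 0) (unitTangent Y) (p, t)) = (0 : ℝ) by
      linarith, mul_zero]
  -- The curve lies on one side of its tangent line, so this height is minimal at `p`; its second
  -- derivative ⟨n, X_pp⟩ ≥ 0 fixes the sign of the curvature vector against `n`.
  have hmin : IsLocalMin (fun q => (inner ℝ n (X q t - X p t) : ℝ)) p :=
    Eventually.of_forall fun q => by
      simpa using hn.inward q
  have hd1 : ∀ q, HasDerivAt (fun q => (inner ℝ n (X q t - X p t) : ℝ))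
      (inner ℝ n (paramDeriv Y (q, t))) q := by
    intro q
    have h1 : HasDerivAt (fun q => X q t) _ q :=
      hasDerivAt_fst (hX.differentiableAt (z := (q, t)) ht)
    simpa using (hasDerivAt_const q n).inner ℝ (h1.sub_const (X p t))
  have hd2 : HasDerivAt (fun q => (inner ℝ n (paramDeriv Y (q, t)) : ℝ))
      (inner ℝ n (paramDeriv (paramDeriv Y) (p, t))) p := by
    have h1 := hasDerivAt_fst (differentiableAt_of_contDiffOn isOpen_pos
      (contDiffOn_dirDeriv isOpen_pos hX.smooth (1, 0)) hz)
    simpa using (hasDerivAt_const p n).inner ℝ h1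
  have h3 := second_deriv_nonneg_of_isLocalMin hmin (Eventually.of_forall hd1) hd2
  have hvT : EqOn (fun y => paramSpeed Y y • unitTangent Y y) (paramDeriv Y)
      (univ ×ˢ Ioi 0) := by
    intro y hy
    change _ • _ = _
    have hne : paramSpeed Y y ≠ 0 := norm_ne_zero_iff.2 (hX.paramDeriv_ne_zero hy.2)
    rw [unitTangent, lengthDeriv, smul_smul, mul_inv_cancel₀ hne, one_smul]
  have h4 := dirDeriv_smul (e := (1, 0)) hvd hTd
  have h5 : dirDeriv (1, 0) (unitTangent Y) (p, t) =
      paramSpeed Y (p, t) • lengthDeriv Y (unitTangent Y) (p, t) := by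
    rw [lengthDeriv, smul_smul, mul_inv_cancel₀ hv.ne', one_smul]
  rw [dirDeriv_congr isOpen_pos hvT hz, h5] at h4
  rw [paramDeriv, h4, inner_add_right, inner_smul_right, inner_smul_right, inner_smul_right, hnT,
    mul_zero, add_zero, ← mul_assoc] at h3
  refine inv_norm_smul_eq_of_orthogonal hn.norm_eq_one (hX.norm_unitTangent ht) hnT hTT hY ?_
  rw [real_inner_comm]
  exact nonneg_of_mul_nonneg_right h3 (mul_pos hv hv)

/-- In a ball in which the speed is positive, a convex complete solution is a smooth flow with
positive curvature. -/
theorem isLocalFlow (hX : IsConvexCompleteSolution α X) (hα : 0 < α)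
    (hpos : ∀ p t, 0 ≤ t → X p t ∈ Metric.ball (0 : Plane) 1 → 0 < speed α X p t) :
    IsLocalFlow α ((univ ×ˢ Ioi 0) ∩ (fun z : ℝ × ℝ => X z.1 z.2) ⁻¹' Metric.ball 0 1)
      (fun z : ℝ × ℝ => X z.1 z.2) := by
  have hcurved : ∀ z ∈ (univ ×ˢ Ioi 0) ∩ (fun z : ℝ × ℝ => X z.1 z.2) ⁻¹' Metric.ball 0 1,
      lengthDeriv (fun z : ℝ × ℝ => X z.1 z.2)
        (unitTangent fun z : ℝ × ℝ => X z.1 z.2) z ≠ 0 := by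
    rintro ⟨p, t⟩ ⟨⟨_, ht⟩, hb⟩ h0
    have h1 := hpos p t (le_of_lt ht) hb
    rw [hX.speed_eq_flowSpeed ht, flowSpeed, familyCurvature, h0, norm_zero,
      Real.zero_rpow hα.ne'] at h1
    exact lt_irrefl _ h1
  refine ⟨hX.smooth.continuousOn.isOpen_inter_preimage isOpen_pos Metric.isOpen_ball,
    hX.smooth.mono inter_subset_left, fun z hz => hX.paramDeriv_ne_zero hz.1.2, hcurved, ?_⟩
  rintro ⟨p, t⟩ hz
  have ht : 0 < t := hz.1.2
  obtain ⟨n, hn, hd⟩ := hX.flow p t ht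
  rw [hX.principalNormal_eq ht hn (hcurved _ hz), ← hX.speed_eq_flowSpeed ht]
  exact (hasDerivAt_snd (hX.differentiableAt (z := (p, t)) ht)).unique hd

/-- The interior gradient estimate in integrated form. -/
theorem exists_localGradient_le {α β M : ℝ} (hα : 0 < α) (hβ : 0 < β) (hβ1 : β < 1)
    (hβα : β < α⁻¹) (hM : 1 ≤ M) :
    ∃ C, 0 ≤ C ∧ ∀ X : ℝ → ℝ → Plane, IsConvexCompleteSolution α X →
      (∀ p t, 0 ≤ t → X p t ∈ Metric.ball (0 : Plane) 1 →
        0 < speed α X p t ∧ speed α X p t ≤ M) →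
      ∀ p T, 0 < T → ‖X p T‖ ≤ 3 / 4 →
        T / 2 * localGradient α β (3 / 4) (fun z : ℝ × ℝ => X z.1 z.2) (p, T) ^ 2 ≤
          C * (1 + T) := by
  obtain ⟨C, hC0, hC⟩ := IsLocalFlow.exists_localGradient_bound hα hβ hβ1 hβα hM
  refine ⟨C, hC0, fun X hX hu p T hT hp => ?_⟩
  have hflow := hX.isLocalFlow hα fun p t ht hb => (hu p t ht hb).1
  set Y := fun z : ℝ × ℝ => X z.1 z.2 with hY
  set U := ((univ : Set ℝ) ×ˢ Ioi (0 : ℝ)) ∩ Y ⁻¹' Metric.ball 0 1 with hU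
  -- Starting at T/2 keeps the region inside t > 0, where the flow is smooth; the weight t - T/2
  -- vanishes at the initial time.
  set D := {z : ℝ × ℝ | z.2 ∈ Icc (T / 2) T ∧ ‖X z.1 z.2‖ ≤ 3 / 4} with hD
  have hDc : IsCompact D := hX.isCompact_region (fun p t ht hb => (hu p t ht hb).2)
    (by linarith) (by linarith) (by norm_num)
  have hDU : D ⊆ U := by
    rintro ⟨q, t⟩ ⟨ht, hq⟩
    refine ⟨⟨mem_univ _, lt_of_lt_of_le (by linarith) ht.1⟩, ?_⟩
    rw [mem_preimage, mem_ball_zero_iff]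
    exact lt_of_le_of_lt hq (by norm_num)
  set Z : ℝ × ℝ → ℝ := fun z => (z.2 - T / 2) * localGradient α β (3 / 4) Y z ^ 2 with hZ
  have hZc : ContinuousOn Z D :=
    (continuous_snd.sub continuous_const).continuousOn.mul
      ((hflow.contDiffOn_localGradient.continuousOn.mono hDU).pow 2)
  have hpD : (p, T) ∈ D := ⟨⟨by linarith, le_rfl⟩, hp⟩
  obtain ⟨⟨q, t⟩, hqD, hmax⟩ := hDc.exists_isMaxOn ⟨_, hpD⟩ hZc
  have hle : Z (p, T) ≤ Z (q, t) := hmax hpD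
  have hZp : Z (p, T) = T / 2 * localGradient α β (3 / 4) Y (p, T) ^ 2 := by
    simp only [hZ]; ring
  rw [← hZp]
  refine hle.trans ?_
  have hCT : 0 ≤ C * (1 + T) := by positivity
  obtain ⟨⟨ht1, ht2⟩, hq⟩ := hqD
  simp only at ht1 ht2 hq
  -- At the initial time, or on the boundary |X| = 3/4, the maximized quantity is zero and the bound
  -- is immediate.
  rcases ht1.eq_or_lt with heq | hlt
  · simpa only [hZ, ← heq, sub_self, zero_mul] using hCT
  have hcut : cutoff (3 / 4) Y (q, t) = (3 / 4) ^ 2 - ‖X q t‖ ^ 2 := by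
    rw [cutoff, real_inner_self_eq_norm_sq]
  rcases hq.eq_or_lt with heq | hqlt
  · have h0 : localGradient α β (3 / 4) Y (q, t) = 0 := by
      rw [localGradient, hcut, heq]; ring
    simpa only [hZ, h0, ne_eq, OfNat.ofNat_ne_zero, not_false_eq_true, zero_pow, mul_zero] using hCT
  have ht0 : 0 < t := by linarith
  have hqU : (q, t) ∈ U := hDU ⟨⟨ht1, ht2⟩, hq⟩
  have hnear : ∀ᶠ z in 𝓝 (q, t), ‖Y z‖ < 3 / 4 :=
    (hX.differentiableAt (z := (q, t)) ht0).continuousAt.norm.eventually_lt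
      continuousAt_const hqlt
  have hspace : ∀ᶠ q' in 𝓝 q, localGradient α β (3 / 4) Y (q', t) ^ 2 ≤
      localGradient α β (3 / 4) Y (q, t) ^ 2 := by
    have hc : ContinuousAt (fun q' : ℝ => (q', t)) q := by fun_prop
    filter_upwards [hc.eventually hnear] with q' hq'
    have : Z (q', t) ≤ Z (q, t) := hmax ⟨⟨ht1, ht2⟩, le_of_lt hq'⟩
    exact le_of_mul_le_mul_left this (by simpa using hlt)
  have htime : ∀ᶠ τ in 𝓝[<] t, (τ - T / 2) * localGradient α β (3 / 4) Y (q, τ) ^ 2 ≤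
      (t - T / 2) * localGradient α β (3 / 4) Y (q, t) ^ 2 := by
    have hc : ContinuousAt (fun τ : ℝ => (q, τ)) t := by fun_prop
    filter_upwards [nhdsWithin_le_nhds (hc.eventually hnear), nhdsWithin_le_nhds
      (Ioi_mem_nhds hlt), self_mem_nhdsWithin] with τ h1 h2 h3
    exact hmax (show (q, τ) ∈ D from
      ⟨⟨le_of_lt h2, (le_of_lt h3).trans ht2⟩, le_of_lt h1⟩)
  have hub : flowSpeed α Y (q, t) ≤ M := by
    rw [← hX.speed_eq_flowSpeed ht0]
    exact (hu q t ht0.le hqU.2).2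
  have hcut0 : 0 < cutoff (3 / 4) Y (q, t) := by
    rw [hcut, sub_pos]
    exact pow_lt_pow_left₀ hqlt (norm_nonneg _) two_ne_zero
  refine (hC (3 / 4) (T / 2) q t U Y hflow hqU (by norm_num) hcut0 hlt hub hspace htime).trans ?_
  exact mul_le_mul_of_nonneg_left (by linarith) hC0

end IsConvexCompleteSolution

/-- Extraction of the gradient bound from the bound of the localized gradient. -/
theorem abs_le_of_localized_bound {C T e x u β : ℝ} (hC : 0 ≤ C) (hT : 0 < T) (hu : 0 < u)
    (he : 5 / 16 ≤ e) (h : T / 2 * (e * (x * u ^ (-β))) ^ 2 ≤ C * (1 + T)) :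
    |x| ≤ √(21 * C) * (1 + T ^ (-(1 / 2 : ℝ))) * u ^ β := by
  set s := T ^ (-(1 / 2 : ℝ)) with hs
  have hs0 : 0 < s := Real.rpow_pos_of_pos hT _
  have hsq : s ^ 2 = T⁻¹ := by
    rw [hs, ← Real.rpow_natCast, ← Real.rpow_mul hT.le]
    norm_num [Real.rpow_neg_one]
  set y := x * u ^ (-β) with hy
  -- Here 5/16 = (3/4)² - (1/2)² is the least value of the cutoff in the half ball; the constant 21
  -- below is 512/25 = 2 (16/5)² rounded up.
  have h1 : (5 / 16) ^ 2 * y ^ 2 ≤ (e * y) ^ 2 := by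
    rw [mul_pow e]
    exact mul_le_mul_of_nonneg_right (pow_le_pow_left₀ (by norm_num) he 2) (sq_nonneg y)
  have h2 : T * (25 / 512 * y ^ 2) ≤ T * (C * (1 + T⁻¹)) := by
    have e1 : T * (C * (1 + T⁻¹)) = C * (1 + T) := by field_simp; ring
    rw [e1]
    refine le_trans ?_ h
    have := mul_le_mul_of_nonneg_left h1 (show 0 ≤ T / 2 by positivity)
    linarith
  have h3 : 25 / 512 * y ^ 2 ≤ C * (1 + T⁻¹) := le_of_mul_le_mul_left h2 hT
  have h4 : y ^ 2 ≤ (√(21 * C) * (1 + s)) ^ 2 := by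
    rw [mul_pow (√(21 * C)), Real.sq_sqrt (by positivity)]
    have h5 : C * (1 + T⁻¹) ≤ C * (1 + s) ^ 2 := by
      rw [← hsq]
      exact mul_le_mul_of_nonneg_left (by linarith) hC
    have h6 : 0 ≤ C * (1 + s) ^ 2 := by positivity
    linarith
  have h6 : |y| ≤ √(21 * C) * (1 + s) := abs_le_of_sq_le_sq h4 (by positivity)
  have hx : |x| = |y| * u ^ β := by
    rw [hy, abs_mul, abs_of_pos (Real.rpow_pos_of_pos hu _), mul_assoc, ← Real.rpow_add hu]
    simp
  rw [hx]
  exact mul_le_mul_of_nonneg_right h6 (Real.rpow_nonneg hu.le _)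

end Solution

end AlphaCSF

theorem proposition3p1 (α β L : ℝ) (hα : 0 < α) (hβ : 0 < β) (hβ' : β < min 1 α⁻¹) :
    ∃ C : ℝ, ∀ X : ℝ → ℝ → AlphaCSF.Plane, AlphaCSF.IsStripSolution α X →
      (∀ p t, 0 ≤ t → X p t ∈ Metric.ball (0 : AlphaCSF.Plane) 1 →
        0 < AlphaCSF.speed α X p t ∧ AlphaCSF.speed α X p t ≤ L) →
      ∀ p t, 0 < t → X p t ∈ Metric.ball (0 : AlphaCSF.Plane) (1 / 2) →
        DifferentiableAt ℝ (fun q => AlphaCSF.speed α X q t) p ∧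
        |AlphaCSF.arcDeriv (fun q => X q t) (fun q => AlphaCSF.speed α X q t) p| ≤
          C * (1 + t ^ (-(1 / 2 : ℝ))) * AlphaCSF.speed α X p t ^ β := by
  -- `L` may be any real number, while the estimate raises its bound to real powers; `max L 1` is
  -- positive and still bounds the speed.
  obtain ⟨C, hC0, hC⟩ := AlphaCSF.IsConvexCompleteSolution.exists_localGradient_le
    (M := max L 1) hα hβ (hβ'.trans_le (min_le_left _ _)) (hβ'.trans_le (min_le_right _ _))
    (le_max_right _ _)
  refine ⟨√(21 * C), fun X hS hu p t ht hp => ?_⟩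
  have hX := hS.solution
  have hflow := hX.isLocalFlow hα fun p t ht hb => (hu p t ht hb).1
  rw [mem_ball_zero_iff] at hp
  have hz : (p, t) ∈ ((univ : Set ℝ) ×ˢ Ioi (0 : ℝ)) ∩
      (fun z : ℝ × ℝ => X z.1 z.2) ⁻¹' Metric.ball 0 1 :=
    ⟨⟨mem_univ _, ht⟩, by rw [mem_preimage, mem_ball_zero_iff]; linarith⟩
  have hd := hflow.diff hflow.contDiffOn_flowSpeed hz
  have hspeed : (fun q => AlphaCSF.speed α X q t) =
      fun q => AlphaCSF.flowSpeed α (fun z : ℝ × ℝ => X z.1 z.2) (q, t) :=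
    funext fun q => hX.speed_eq_flowSpeed ht q
  have hbound := hC X hX (fun p t ht hb => ⟨(hu p t ht hb).1, (hu p t ht hb).2.trans
    (le_max_left _ _)⟩) p t ht (by linarith)
  rw [hX.speed_eq_flowSpeed ht p, hspeed,
    AlphaCSF.arcDeriv_eq_lengthDeriv (hX.differentiableAt (z := (p, t)) ht) hd]
  refine ⟨(AlphaCSF.hasDerivAt_fst hd).differentiableAt, ?_⟩
  refine AlphaCSF.abs_le_of_localized_bound hC0 ht (hflow.flowSpeed_pos hz) ?_ hbound
  have hn : ‖X p t‖ ^ 2 ≤ (1 / 2) ^ 2 := pow_le_pow_left₀ (norm_nonneg _) hp.le 2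
  rw [AlphaCSF.cutoff, real_inner_self_eq_norm_sq]
  linarith
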